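/- Let $\mu,\alpha,\lambda_c,P_W,P_L,\Gamma_{cs},\Gamma_{ed}>0$, $\lambda_W>0$, $\lambda_L\ge 0$, and let $l(d)=(4\pi/\lambda_c)^2d^{\alpha}$ be the path loss at distance $d$. Let the Wi-Fi access points (APs) $\Phi_W=\{x_i\}$ and the LTE base stations (eNBs) $\Phi_L=\{y_k\}$ be independent homogeneous Poisson point processes on $\mathbb{R}^2$ with intensities $\lambda_W$ and $\lambda_L$. Each AP $x_i$ has a back-off timer $t_i$ uniform on $[0,1]$; the fading $G^{W}_{ji}$ of the channel from AP $x_j$ to AP $x_i$ ($j\ne i$) and the fading $G^{LW}_{ki}$ of the channel from eNB $y_k$ to AP $x_i$ are exponential with parameter (rate) $\mu$. All timers and fading variables are mutually independent and independent of $(\Phi_W,\Phi_L)$. When LTE transmits continuously, the medium access indicator of AP $x_i$ is $$e_i=\prod_{y_k\in\Phi_L}\mathbf 1\Big\{\tfrac{G^{LW}_{ki}}{l(\|y_k-x_i\|)}\le\tfrac{\Gamma_{ed}}{P_L}\Big\}\prod_{x_j\in\Phi_W\setminus\{x_i\}}\Big(\mathbf 1\{t_j\ge t_i\}+\mathbf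 1\{t_j<t_i\}\,\mathbf 1\Big\{\tfrac{G^{W}_{ji}}{l(\|x_j-x_i\|)}\le\tfrac{\Gamma_{cs}}{P_W}\Big\}\Big).$$ Put $$N^L=\lambda_L\int_{\mathbb{R}^2}\exp\Big(-\mu\tfrac{\Gamma_{ed}}{P_L}l(\|x\|)\Big)\,dx,\qquad N^W=\lambda_W\int_{\mathbb{R}^2}\exp\Big(-\mu\tfrac{\Gamma_{cs}}{P_W}l(\|x\|)\Big)\,dx .$$ Then both integrals are finite, $N^W>0$, and the medium access probability of a typical AP, that is, the Palm probability that its indicator equals $1$, is $$\frac{1}{\lambda_W|B|}\,\mathbb{E}\big[\#\{i: x_i\in B,\ e_i=1\}\big]=\exp(-N^L)\,\frac{1-\exp(-N^W)}{N^W}$$ for every Borel set $B\subset\mathbb{R}^2$ of area $|B|\in(0,\infty)$. -/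

import Mathlib

open MeasureTheory ProbabilityTheory Set
open scoped ENNReal NNReal

noncomputable section

namespace WifiLte

/-- The Euclidean plane `ℝ²`; `volume` on it is Lebesgue measure (area). -/
abbrev Plane : Type := EuclideanSpace ℝ (Fin 2)

/-- The random counting measure `∑ᵢ δ_{xᵢ}` of an enumerated point process `{xᵢ}`. -/
def countingMeasure {Ω ι : Type*} (x : ι → Ω → Plane) (ω : Ω) : Measure Plane :=
  Measure.sum fun i => Measure.dirac (x i ω)

/-- `{xᵢ}` is a homogeneous Poisson point process of intensity `lam` on the plane: the number of
points in a region of finite area `A` is Poisson with mean `lam * A`, and the numbers of points in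
pairwise disjoint regions are independent. -/
structure IsPoissonPointProcess {Ω ι : Type*} [MeasurableSpace Ω] (P : Measure Ω)
    (x : ι → Ω → Plane) (lam : ℝ) : Prop where
  measurable : ∀ i, Measurable (x i)
  law_count : ∀ B : Set Plane, MeasurableSet B → volume B ≠ ∞ →
    HasLaw (fun ω => countingMeasure x ω B)
      ((poissonMeasure (lam * (volume B).toReal).toNNReal).map (Nat.cast : ℕ → ℝ≥0∞)) P
  indep_count : ∀ (n : ℕ) (B : Fin n → Set Plane), (∀ k, MeasurableSet (B k)) →
    Pairwise (fun k l => Disjoint (B k) (B l)) →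
    iIndepFun (fun k ω => countingMeasure x ω (B k)) P

/-- The deterministic parameters: AP and eNB intensities, transmit powers, carrier sense and energy
detection thresholds, fading parameter, path loss exponent and wavelength. -/
structure Parameters where
  lamW : ℝ
  lamL : ℝ
  powW : ℝ
  powL : ℝ
  thrCS : ℝ
  thrED : ℝ
  mu : ℝ
  alpha : ℝ
  wavelength : ℝ
  lamW_pos : 0 < lamW
  lamL_nonneg : 0 ≤ lamL
  powW_pos : 0 < powW
  powL_pos : 0 < powL
  thrCS_pos : 0 < thrCS
  thrED_pos : 0 < thrED
  mu_pos : 0 < mu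
  alpha_pos : 0 < alpha
  wavelength_pos : 0 < wavelength

/-- Free space path loss in linear scale, `l(d) = (4π / λ_c)² d^α`. -/
def Parameters.pathLoss (q : Parameters) (d : ℝ) : ℝ :=
  (4 * Real.pi / q.wavelength) ^ 2 * d ^ q.alpha

/-- In decibels the path loss is `20 log₁₀ (4π / λ_c) + 10 α log₁₀ d`. -/
theorem Parameters.pathLoss_dB (q : Parameters) {d : ℝ} (hd : 0 < d) :
    10 * Real.logb 10 (q.pathLoss d) =
      20 * Real.logb 10 (4 * Real.pi / q.wavelength) + 10 * q.alpha * Real.logb 10 d := by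
  have h : 0 < 4 * Real.pi / q.wavelength := div_pos (by positivity) q.wavelength_pos
  have h' : 0 < d ^ q.alpha := Real.rpow_pos_of_pos hd _
  rw [Parameters.pathLoss, Real.logb_mul (by positivity) h'.ne', Real.logb_pow,
    Real.logb_rpow_eq_mul_logb_of_pos hd]
  push_cast
  ring

/-- `N₀(y, r, Γ) = lam ∫_{ℝ² ∖ B(0,r)} exp (-μ (Γ / pow) l(‖x - y‖)) dx`, for transmitters of
intensity `lam` and transmit power `pow`. -/
def Parameters.meanContenders (q : Parameters) (lam pow : ℝ) (y : Plane) (r thr : ℝ) : ℝ :=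
  lam * ∫ x in (Metric.closedBall (0 : Plane) r)ᶜ,
    Real.exp (-q.mu * (thr / pow) * q.pathLoss ‖x - y‖)

/-- `N^L = N₀^L(o, 0, Γ_ed)`. -/
def Parameters.NL (q : Parameters) : ℝ := q.meanContenders q.lamL q.powL 0 0 q.thrED

/-- `N^W = N₀^W(o, 0, Γ_cs)`. -/
def Parameters.NW (q : Parameters) : ℝ := q.meanContenders q.lamW q.powW 0 0 q.thrCS

/-- The random elements of the network; APs are indexed by `ι` and eNBs by `κ`. -/
structure Network (Ω ι κ : Type*) where
  /-- location of the AP `i` -/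
  ap : ι → Ω → Plane
  /-- location of the eNB `k` -/
  enb : κ → Ω → Plane
  /-- back-off timer of the AP `i` -/
  timer : ι → Ω → ℝ
  /-- `fadW j i` is the fading of the channel from the AP `j` to the AP `i ≠ j` (the diagonal plays
  no role) -/
  fadW : ι → ι → Ω → ℝ
  /-- `fadLW k i` is the fading of the channel from the eNB `k` to the AP `i` -/
  fadLW : κ → ι → Ω → ℝ

namespace Network

variable {Ω ι κ : Type*}

/-- All timers and fading variables, as one family. -/
def marks (S : Network Ω ι κ) : ι ⊕ (ι × ι) ⊕ (κ × ι) → Ω → ℝ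
  | Sum.inl i => S.timer i
  | Sum.inr (Sum.inl (j, i)) => S.fadW j i
  | Sum.inr (Sum.inr (k, i)) => S.fadLW k i

/-- The probabilistic model: APs and eNBs are independent homogeneous Poisson point processes; the
timers are uniform on `[0, 1]`, the fading variables are exponential with parameter `μ`, all of
these are mutually independent, and they are independent of the locations. -/
structure IsModel [MeasurableSpace Ω] (S : Network Ω ι κ) (q : Parameters) (P : Measure Ω) :
    Prop where
  ap_poisson : IsPoissonPointProcess P S.ap q.lamW
  enb_poisson : IsPoissonPointProcess P S.enb q.lamL
  measurable_marks : ∀ m, Measurable (S.marks m)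
  timer_uniform : ∀ i, pdf.IsUniform (S.timer i) (Icc (0 : ℝ) 1) P
  fadW_exp : ∀ j i, HasLaw (S.fadW j i) (expMeasure q.mu) P
  fadLW_exp : ∀ k i, HasLaw (S.fadLW k i) (expMeasure q.mu) P
  indep_locations : IndepFun (fun ω i => S.ap i ω) (fun ω k => S.enb k ω) P
  indep_marks : iIndepFun S.marks P
  indep_locations_marks :
    IndepFun (fun ω => ((fun i => S.ap i ω), (fun k => S.enb k ω))) (fun ω m => S.marks m ω) P

/-- The medium access indicator of the AP `i` when LTE transmits continuously: a product of
indicators over all eNBs and all other APs. -/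
def accessIndicator (S : Network Ω ι κ) (q : Parameters) (i : ι) (ω : Ω) : ℝ :=
  (∏' k : κ, if S.fadLW k i ω / q.pathLoss ‖S.enb k ω - S.ap i ω‖ ≤ q.thrED / q.powL
      then 1 else 0) *
  ∏' j : {j : ι // j ≠ i},
    ((if S.timer j ω ≥ S.timer i ω then 1 else 0) +
      (if S.timer j ω < S.timer i ω then 1 else 0) *
      (if S.fadW j i ω / q.pathLoss ‖S.ap j ω - S.ap i ω‖ ≤ q.thrCS / q.powW then 1 else 0))

/-- The Palm probability that the medium access indicator of a typical AP equals `1`, computed with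
the sampling region `B`: the expected number of APs in `B` whose indicator equals `1`, divided by
the expected number `λ_W |B|` of APs in `B`. (The indicator depends only on the marked
configuration seen from the AP, so this is the Palm probability of a stationary point process.) -/
def mediumAccessProb [MeasurableSpace Ω] (S : Network Ω ι κ) (q : Parameters) (P : Measure Ω)
    (B : Set Plane) : ℝ≥0∞ :=
  (∫⁻ ω, ∑' i, {ω' | S.ap i ω' ∈ B ∧ S.accessIndicator q i ω' = 1}.indicator 1 ω ∂P) /
    (ENNReal.ofReal q.lamW * volume B)

end Network

end WifiLte

end

/-! Fix all locations and the timer value t of the AP x_i. By the exponential tail, an eNB at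
displacement z is detected with probability p_L(z) = exp(-μ (Γ_ed/P_L) l(‖z‖)), and x_j silences x_i
with probability t p_W(x_j - x_i), with p_W defined likewise, since {t_j < t} has probability t.
These events are independent, so the conditional access probability is ∏ (1 - p_L) ∏ (1 - t p_W)
(`measure_access`, which also averages over t). Averaging over the eNBs by the Laplace functional E
exp(-∑ φ) = exp(-λ ∫ (1 - e^{-φ})) gives exp(-N^L), wherever x_i is. Summing over x_i in B and
averaging over the APs by the Mecke formula gives λ_W |B| exp(-t N^W): seen from one of its points,
the rest of the process is again Poisson. Finally ∫₀¹ exp(-t N^W) dt = (1 - exp(-N^W)) / N^W.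

Products ∏ (1 - r) are written as exp(-∑ -log(1 - r)) with sums in [0, ∞], so convergence is never
an issue and 1 - e^{-φ} gives back r.

The point processes are known only through their counts, so both formulas are derived from these
(`lintegral_negExp_tsum`, `tsum_lintegral_negExp`). If points are seen only through finitely many
labels, the label counts are independent and, for cells of finite area m / λ, the formulas reduce to
E a^N = e^{-m(1-a)} and E N a^{N-1} = m e^{-m(1-a)}. The general case is a limit: simple functions
suffice for Laplace, while a two-point kernel is approximated by finite suprema of rectangle
indicators, which increase to any lower semicontinuous kernel. -/

noncomputable section

namespace WifiLte

open Filter Topology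

/-! ### Exponential and logarithm on [0, ∞] -/

/-- `exp (-a)` for an extended nonnegative number `a`, with `exp (-∞) = 0`. -/
def negExp (a : ℝ≥0∞) : ℝ≥0∞ := EReal.exp (-(a : EReal))

@[simp] lemma negExp_zero : negExp 0 = 1 := by simp [negExp]

lemma negExp_add (a b : ℝ≥0∞) : negExp (a + b) = negExp a * negExp b := by
  unfold negExp
  rw [EReal.coe_ennreal_add, EReal.neg_add (.inl (by simp)) (.inr (by simp)), sub_eq_add_neg,
    EReal.exp_add]

lemma negExp_ofReal {x : ℝ} (hx : 0 ≤ x) :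
    negExp (ENNReal.ofReal x) = ENNReal.ofReal (Real.exp (-x)) := by
  rw [negExp, EReal.coe_ennreal_ofReal, max_eq_left hx, ← EReal.coe_neg, EReal.exp_coe]

lemma continuous_negExp : Continuous negExp :=
  ENNReal.continuous_exp.comp (continuous_neg.comp continuous_coe_ennreal_ereal)

lemma measurable_negExp : Measurable negExp := continuous_negExp.measurable

lemma antitone_negExp : Antitone negExp := fun a b h => by
  unfold negExp
  exact EReal.exp_monotone (EReal.neg_le_neg_iff.2 (by exact_mod_cast h))

lemma negExp_le_one (a : ℝ≥0∞) : negExp a ≤ 1 := by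
  simpa using antitone_negExp (zero_le : 0 ≤ a)

lemma negExp_sum {T : Type*} (s : Finset T) (f : T → ℝ≥0∞) :
    negExp (∑ t ∈ s, f t) = ∏ t ∈ s, negExp (f t) := by
  classical
  induction s using Finset.induction_on with
  | empty => simp
  | insert t s ht ih => rw [Finset.sum_insert ht, Finset.prod_insert ht, negExp_add, ih]

lemma negExp_mul_nat (a : ℝ≥0∞) (n : ℕ) : negExp (a * n) = negExp a ^ n := by
  induction n with
  | zero => simp
  | succ n ih => rw [Nat.cast_succ, mul_add, mul_one, negExp_add, ih, pow_succ]

/-- `-log (1 - r)` for `r ∈ [0, 1]`. -/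
def negLogOneSub (r : ℝ≥0∞) : ℝ≥0∞ := (-ENNReal.log (1 - r)).toENNReal

lemma negExp_negLogOneSub (r : ℝ≥0∞) : negExp (negLogOneSub r) = 1 - r := by
  have h : 0 ≤ -ENNReal.log (1 - r) := by
    rw [EReal.le_neg, neg_zero]
    simp
  rw [negExp, negLogOneSub, EReal.coe_toENNReal h, neg_neg, ENNReal.exp_log]

lemma one_sub_negExp_negLogOneSub {r : ℝ≥0∞} (hr : r ≤ 1) :
    1 - negExp (negLogOneSub r) = r := by
  rw [negExp_negLogOneSub, ENNReal.sub_sub_cancel ENNReal.one_ne_top hr]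

lemma continuous_negLogOneSub : Continuous negLogOneSub :=
  EReal.continuous_toENNReal.comp (continuous_neg.comp
    (ENNReal.continuous_log.comp (ENNReal.continuous_sub_left ENNReal.one_ne_top)))

lemma monotone_negLogOneSub : Monotone negLogOneSub := fun a b h => by
  unfold negLogOneSub
  refine EReal.toENNReal_le_toENNReal (EReal.neg_le_neg_iff.2 (ENNReal.log_monotone ?_))
  exact tsub_le_tsub_left h 1

lemma measurable_negLogOneSub : Measurable negLogOneSub := continuous_negLogOneSub.measurable

/-! ### Poisson generating functions -/

section Poisson

lemma lintegral_poissonMeasure (r : ℝ≥0) (f : ℕ → ℝ≥0∞) :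
    ∫⁻ n, f n ∂poissonMeasure r =
      ∑' n : ℕ, ENNReal.ofReal (Real.exp (-r) * r ^ n / n.factorial) * f n := by
  rw [poissonMeasure, lintegral_sum_measure]
  simp [lintegral_smul_measure]

lemma tsum_poisson_mul_pow (r : ℝ≥0) {a : ℝ≥0∞} (ha : a ≤ 1) :
    ∑' n : ℕ, ENNReal.ofReal (Real.exp (-r) * r ^ n / n.factorial) * a ^ n =
      negExp (r * (1 - a)) := by
  lift a to ℝ≥0 using ne_top_of_le_ne_top ENNReal.one_ne_top ha
  have ha' : (a : ℝ) ≤ 1 := by exact_mod_cast ha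
  have hnn : 0 ≤ (r : ℝ) * (1 - a) := mul_nonneg r.2 (sub_nonneg.2 ha')
  have hs : HasSum (fun n : ℕ => Real.exp (-r) * (((r : ℝ) * a) ^ n / n.factorial))
      (Real.exp (-r) * Real.exp (r * a)) := by
    have := NormedSpace.expSeries_div_hasSum_exp ((r : ℝ) * a)
    rw [← Real.exp_eq_exp_ℝ] at this
    exact this.mul_left _
  have h1 : ∀ n : ℕ, ENNReal.ofReal (Real.exp (-r) * r ^ n / n.factorial) * (a : ℝ≥0∞) ^ n =
      ENNReal.ofReal (Real.exp (-r) * (((r : ℝ) * a) ^ n / n.factorial)) := fun n => by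
    rw [← ENNReal.ofReal_coe_nnreal (p := a), ← ENNReal.ofReal_pow (by positivity),
      ← ENNReal.ofReal_mul (by positivity)]
    congr 1
    rw [mul_pow]
    ring
  have h2 : (r : ℝ≥0∞) * (1 - a) = ENNReal.ofReal (r * (1 - a)) := by
    rw [ENNReal.ofReal_mul (by positivity), ENNReal.ofReal_sub _ (by positivity)]
    simp
  simp_rw [h1]
  rw [← ENNReal.ofReal_tsum_of_nonneg (fun n => by positivity) hs.summable, hs.tsum_eq, h2,
    negExp_ofReal hnn, ← Real.exp_add]
  congr 2
  ring

/-- Shifting the index by one cancels n against the factorial and leaves the generating function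
times r: a size-biased Poisson variable minus one is again Poisson. -/
lemma tsum_poisson_mul_nat_mul_pow (r : ℝ≥0) {a : ℝ≥0∞} (ha : a ≤ 1) :
    ∑' n : ℕ, ENNReal.ofReal (Real.exp (-r) * r ^ n / n.factorial) * (n * a ^ (n - 1)) =
      r * negExp (r * (1 - a)) := by
  rw [tsum_eq_zero_add' ENNReal.summable, ← tsum_poisson_mul_pow r ha, ← ENNReal.tsum_mul_left]
  simp only [Nat.cast_zero, zero_mul, mul_zero, zero_add, Nat.add_sub_cancel]
  refine tsum_congr fun n => ?_
  rw [← mul_assoc, ← mul_assoc]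
  congr 1
  rw [← ENNReal.ofReal_natCast, ← ENNReal.ofReal_coe_nnreal (p := r),
    ← ENNReal.ofReal_mul (by positivity), ← ENNReal.ofReal_mul (by positivity)]
  congr 1
  rw [Nat.factorial_succ]
  push_cast
  field_simp
  ring

end Poisson

/-! ### Counts of a Poisson process and finitely many labels -/

lemma coe_toNNReal_mul_volume {lam : ℝ} (hlam : 0 ≤ lam) {B : Set Plane} (hB : volume B ≠ ∞) :
    (((lam * (volume B).toReal).toNNReal : ℝ≥0) : ℝ≥0∞) = ENNReal.ofReal lam * volume B := by
  change ENNReal.ofReal _ = _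
  rw [ENNReal.ofReal_mul hlam, ENNReal.ofReal_toReal hB]

lemma lintegral_comp_label {T : Type*} [Fintype T] [MeasurableSpace T]
    [MeasurableSingletonClass T] {lab : Plane → T} (hlab : Measurable lab) (ν : Measure Plane) (c : T → ℝ≥0∞) :
    ∫⁻ y, c (lab y) ∂ν = ∑ t, c t * ν (lab ⁻¹' {t}) := by
  rw [← lintegral_map (Measurable.of_discrete (f := c)) hlab, lintegral_fintype]
  exact Finset.sum_congr rfl fun t _ => by rw [Measure.map_apply hlab (measurableSet_singleton t)]

section PointProcess

variable {Ω ι : Type*} {x : ι → Ω → Plane} {lam : ℝ}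

lemma lintegral_countingMeasure (ω : Ω) {f : Plane → ℝ≥0∞} (hf : Measurable f) :
    ∫⁻ y, f y ∂countingMeasure x ω = ∑' i, f (x i ω) := by
  rw [countingMeasure, lintegral_sum_measure]
  exact tsum_congr fun i => lintegral_dirac' _ hf

lemma countingMeasure_apply (ω : Ω) {B : Set Plane} (hB : MeasurableSet B) :
    countingMeasure x ω B = ∑' i, B.indicator 1 (x i ω) := by
  rw [← lintegral_countingMeasure ω (measurable_one.indicator hB), lintegral_indicator_one hB]

variable [MeasurableSpace Ω] {P : Measure Ω}

lemma measurable_countingMeasure [Countable ι] (hx : ∀ i, Measurable (x i)) {B : Set Plane}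
    (hB : MeasurableSet B) : Measurable fun ω => countingMeasure x ω B := by
  simp_rw [countingMeasure_apply _ hB]
  exact Measurable.tsum fun i => (measurable_one.indicator hB).comp (hx i)

namespace IsPoissonPointProcess

lemma lintegral_comp_count (hx : IsPoissonPointProcess P x lam) {B : Set Plane}
    (hB : MeasurableSet B) (hB' : volume B ≠ ∞) {f : ℝ≥0∞ → ℝ≥0∞} (hf : Measurable f) :
    ∫⁻ ω, f (countingMeasure x ω B) ∂P =
      ∑' n : ℕ, ENNReal.ofReal (Real.exp (-(lam * (volume B).toReal).toNNReal) *
        (lam * (volume B).toReal).toNNReal ^ n / n.factorial) * f n := by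
  rw [(hx.law_count B hB hB').lintegral_comp hf.aemeasurable, lintegral_map hf .of_discrete,
    lintegral_poissonMeasure]

lemma lintegral_negExp_mul_count_of_ne_top (hx : IsPoissonPointProcess P x lam) (hlam : 0 ≤ lam)
    {B : Set Plane} (hB : MeasurableSet B) (hB' : volume B ≠ ∞) (s : ℝ≥0∞) :
    ∫⁻ ω, negExp (s * countingMeasure x ω B) ∂P =
      negExp (ENNReal.ofReal lam * volume B * (1 - negExp s)) := by
  rw [hx.lintegral_comp_count hB hB' (f := fun n => negExp (s * n))
    (measurable_negExp.comp (measurable_const_mul s))]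
  simp_rw [negExp_mul_nat]
  rw [tsum_poisson_mul_pow _ (negExp_le_one s), coe_toNNReal_mul_volume hlam hB']

/-- The Mecke formula for a single cell: each of the N points in B sees N - 1 others there. -/
lemma lintegral_count_mul_negExp (hx : IsPoissonPointProcess P x lam) (hlam : 0 ≤ lam)
    {B : Set Plane} (hB : MeasurableSet B) (hB' : volume B ≠ ∞) (s : ℝ≥0∞) :
    ∫⁻ ω, countingMeasure x ω B * negExp (s * (countingMeasure x ω B - 1)) ∂P =
      ENNReal.ofReal lam * volume B *
        negExp (ENNReal.ofReal lam * volume B * (1 - negExp s)) := by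
  rw [hx.lintegral_comp_count hB hB' (f := fun n => n * negExp (s * (n - 1)))
    (measurable_id.mul (measurable_negExp.comp ((measurable_id.sub_const 1).const_mul s)))]
  have : ∀ n : ℕ, (n : ℝ≥0∞) - 1 = ((n - 1 : ℕ) : ℝ≥0∞) := fun n => by push_cast; rfl
  simp_rw [this, negExp_mul_nat]
  rw [tsum_poisson_mul_nat_mul_pow _ (negExp_le_one s), coe_toNNReal_mul_volume hlam hB']

/-- The Laplace transform of the number of points in a region, possibly of infinite area. -/
lemma lintegral_negExp_mul_count [IsProbabilityMeasure P] [Countable ι] (hx : IsPoissonPointProcess P x lam)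
    (hlam : 0 ≤ lam) {B : Set Plane} (hB : MeasurableSet B) (s : ℝ≥0∞) :
    ∫⁻ ω, negExp (s * countingMeasure x ω B) ∂P =
      negExp (ENNReal.ofReal lam * volume B * (1 - negExp s)) := by
  -- The count law is given only for finite area, so B is exhausted by bounded pieces. A finite
  -- partition of the plane always has a cell of infinite area.
  set D : ℕ → Set Plane := fun n => B ∩ Metric.closedBall 0 n with hD
  have hDm : ∀ n, MeasurableSet (D n) := fun n => hB.inter Metric.isClosed_closedBall.measurableSet
  have hmono : Monotone D := fun m n h =>
    inter_subset_inter_right _ (Metric.closedBall_subset_closedBall (by exact_mod_cast h))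
  have hU : ⋃ n, D n = B := by
    rw [← inter_iUnion, Metric.iUnion_closedBall_nat, inter_univ]
  have hfin : ∀ n, volume (D n) ≠ ∞ := fun n =>
    ne_top_of_le_ne_top (measure_closedBall_lt_top (x := (0 : Plane)) (r := n)).ne
      (measure_mono inter_subset_right)
  have lim : ∀ ν : Measure Plane, Tendsto (fun n => ν (D n)) atTop (𝓝 (ν B)) := fun ν => by
    have := tendsto_measure_iUnion_atTop (μ := ν) hmono
    rwa [hU] at this
  have h1 : Tendsto (fun n => ∫⁻ ω, negExp (s * countingMeasure x ω (D n)) ∂P) atTop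
      (𝓝 (∫⁻ ω, negExp (s * countingMeasure x ω B) ∂P)) := by
    refine tendsto_lintegral_of_dominated_convergence (fun _ => 1)
      (fun n => measurable_negExp.comp
        ((measurable_countingMeasure hx.measurable (hDm n)).const_mul s))
      (fun n => ae_of_all _ fun ω => negExp_le_one _) (by simp) (ae_of_all _ fun ω => ?_)
    have hm : Monotone fun n => s * countingMeasure x ω (D n) :=
      fun m n h => mul_le_mul_right (measure_mono (hmono h)) s
    refine (continuous_negExp.tendsto _).comp ?_
    convert tendsto_atTop_iSup hm
    rw [← ENNReal.mul_iSup]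
    congr 1
    exact tendsto_nhds_unique (lim _) (tendsto_atTop_iSup fun m n h => measure_mono (hmono h))
  have h2 : Tendsto (fun n => negExp (ENNReal.ofReal lam * volume (D n) * (1 - negExp s))) atTop
      (𝓝 (negExp (ENNReal.ofReal lam * volume B * (1 - negExp s)))) := by
    refine (continuous_negExp.tendsto _).comp ?_
    exact ENNReal.Tendsto.mul_const (ENNReal.Tendsto.const_mul (lim _) (.inr ENNReal.ofReal_ne_top))
      (.inr (by simp))
  refine tendsto_nhds_unique (h1.congr fun n => ?_) h2
  exact hx.lintegral_negExp_mul_count_of_ne_top hlam (hDm n) (hfin n) s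

section Labels

variable {T : Type*} [Fintype T] [MeasurableSpace T] [MeasurableSingletonClass T]
  {lab : Plane → T}

lemma lintegral_prod_count_label [IsProbabilityMeasure P] [Countable ι]
    (hx : IsPoissonPointProcess P x lam) (hlab : Measurable lab) {f : T → ℝ≥0∞ → ℝ≥0∞}
    (hf : ∀ t, Measurable (f t)) :
    ∫⁻ ω, ∏ t, f t (countingMeasure x ω (lab ⁻¹' {t})) ∂P =
      ∏ t, ∫⁻ ω, f t (countingMeasure x ω (lab ⁻¹' {t})) ∂P := by
  have hm : ∀ t, MeasurableSet (lab ⁻¹' {t}) := fun t => hlab (measurableSet_singleton t)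
  have h := hx.indep_count _ (fun k => lab ⁻¹' {(Fintype.equivFin T).symm k}) (fun k => hm _)
    (fun k l hkl => by
      refine Disjoint.preimage _ (disjoint_singleton.2 ?_)
      exact fun h => hkl ((Fintype.equivFin T).symm.injective h))
  have h' := h.precomp (Fintype.equivFin T).injective
  simp only [Equiv.symm_apply_apply] at h'
  have h'' := h'.comp f hf
  exact lintegral_prod_eq_prod_lintegral_of_indepFun Finset.univ _ h''
    fun t => (hf t).comp (measurable_countingMeasure hx.measurable (hm t))

/-- The sum over points is ∑ c_t N_t with N_t the independent counts of the label cells, so the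
expectation factors over t. -/
lemma lintegral_negExp_tsum_label [IsProbabilityMeasure P] [Countable ι] (hx : IsPoissonPointProcess P x lam)
    (hlam : 0 ≤ lam) (hlab : Measurable lab) (c : T → ℝ≥0∞) :
    ∫⁻ ω, negExp (∑' i, c (lab (x i ω))) ∂P =
      negExp (ENNReal.ofReal lam * ∫⁻ y, (1 - negExp (c (lab y)))) := by
  have h1 : ∀ ω, negExp (∑' i, c (lab (x i ω))) =
      ∏ t, negExp (c t * countingMeasure x ω (lab ⁻¹' {t})) := fun ω => by
    rw [← negExp_sum, ← lintegral_comp_label hlab,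
      lintegral_countingMeasure ω (f := fun y => c (lab y)) (Measurable.of_discrete.comp hlab)]
  simp_rw [h1]
  rw [hx.lintegral_prod_count_label hlab (f := fun t n => negExp (c t * n))
    (fun t => measurable_negExp.comp (measurable_const_mul _)),
    lintegral_comp_label hlab volume (fun t => 1 - negExp (c t)), Finset.mul_sum, negExp_sum]
  refine Finset.prod_congr rfl fun t _ => ?_
  rw [hx.lintegral_negExp_mul_count hlam (hlab (measurableSet_singleton t))]
  congr 1
  ring

end Labels

end IsPoissonPointProcess

end PointProcess

/-! ### Convergence lemmas and the Laplace functional -/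

lemma tsum_eq_add_tsum_ne {ι : Type*} (f : ι → ℝ≥0∞) (i : ι) :
    ∑' j, f j = f i + ∑' j : {j // j ≠ i}, f j := by
  rw [← Summable.tsum_add_tsum_compl (s := {i}) ENNReal.summable ENNReal.summable]
  congr 1
  exact tsum_singleton i f

lemma tsum_comp_eq_sum_mul_tsum {J T : Type*} [Fintype T] [DecidableEq T] (c : T → ℝ≥0∞)
    (l : J → T) : ∑' j, c (l j) = ∑ t, c t * ∑' j, if l j = t then 1 else 0 := by
  have : ∀ j, c (l j) = ∑ t, c t * if l j = t then 1 else 0 := fun j => by simp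
  simp_rw [this]
  rw [Summable.tsum_finsetSum fun _ _ => ENNReal.summable]
  simp_rw [ENNReal.tsum_mul_left]

lemma tendsto_tsum_of_monotone {J : Type*} {f : ℕ → J → ℝ≥0∞} {g : J → ℝ≥0∞}
    (hf : ∀ j, Monotone fun n => f n j) (h : ∀ j, Tendsto (fun n => f n j) atTop (𝓝 (g j))) :
    Tendsto (fun n => ∑' j, f n j) atTop (𝓝 (∑' j, g j)) := by
  let _ : MeasurableSpace J := ⊤
  simp_rw [← lintegral_count]
  exact lintegral_tendsto_of_tendsto_of_monotone (fun n => Measurable.of_discrete.aemeasurable)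
    (ae_of_all _ hf) (ae_of_all _ h)

/-- Dominated convergence for series of extended nonnegative numbers. -/
lemma tendsto_tsum_of_dominated {J : Type*} [Countable J] {f : ℕ → J → ℝ≥0∞} {g b : J → ℝ≥0∞}
    (hb : ∑' j, b j ≠ ∞) (hf : ∀ n j, f n j ≤ b j)
    (h : ∀ j, Tendsto (fun n => f n j) atTop (𝓝 (g j))) :
    Tendsto (fun n => ∑' j, f n j) atTop (𝓝 (∑' j, g j)) := by
  let _ : MeasurableSpace J := ⊤
  simp_rw [← lintegral_count] at hb ⊢
  exact tendsto_lintegral_of_dominated_convergence b (fun n => Measurable.of_discrete)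
    (fun n => ae_of_all _ (hf n)) hb (ae_of_all _ h)

lemma tendsto_lintegral_one_sub_negExp {f : ℕ → Plane → ℝ≥0∞} {g : Plane → ℝ≥0∞}
    (hm : ∀ n, Measurable (f n)) (hf : ∀ y, Monotone fun n => f n y)
    (h : ∀ y, Tendsto (fun n => f n y) atTop (𝓝 (g y))) :
    Tendsto (fun n => ∫⁻ y, (1 - negExp (f n y))) atTop (𝓝 (∫⁻ y, (1 - negExp (g y)))) := by
  refine lintegral_tendsto_of_tendsto_of_monotone
    (fun n => (measurable_const.sub (measurable_negExp.comp (hm n))).aemeasurable)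
    (ae_of_all _ fun y m n hmn => tsub_le_tsub_left (antitone_negExp (hf y hmn)) 1)
    (ae_of_all _ fun y => ?_)
  exact ((ENNReal.continuous_sub_left ENNReal.one_ne_top).comp continuous_negExp).tendsto _
    |>.comp (h y)

lemma tendsto_negExp_ofReal_mul {u : ℕ → ℝ≥0∞} {a : ℝ≥0∞} (h : Tendsto u atTop (𝓝 a)) (lam : ℝ) :
    Tendsto (fun n => negExp (ENNReal.ofReal lam * u n)) atTop
      (𝓝 (negExp (ENNReal.ofReal lam * a))) :=
  (continuous_negExp.tendsto _).comp (ENNReal.Tendsto.const_mul h (.inr ENNReal.ofReal_ne_top))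

namespace IsPoissonPointProcess

variable {Ω ι : Type*} {x : ι → Ω → Plane} {lam : ℝ} [MeasurableSpace Ω] {P : Measure Ω}

/-- The Laplace functional of a homogeneous Poisson point process. -/
theorem lintegral_negExp_tsum [IsProbabilityMeasure P] [Countable ι]
    (hx : IsPoissonPointProcess P x lam) (hlam : 0 ≤ lam) {φ : Plane → ℝ≥0∞} (hφ : Measurable φ) :
    ∫⁻ ω, negExp (∑' i, φ (x i ω)) ∂P =
      negExp (ENNReal.ofReal lam * ∫⁻ y, (1 - negExp (φ y))) := by
  let f := SimpleFunc.eapprox φ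
  have hf : ∀ y, Monotone fun n => f n y := fun y m n h => SimpleFunc.monotone_eapprox φ h y
  have hlim : ∀ y, Tendsto (fun n => f n y) atTop (𝓝 (φ y)) := fun y => by
    rw [← SimpleFunc.iSup_eapprox_apply hφ]
    exact tendsto_atTop_iSup (hf y)
  have h1 : Tendsto (fun n => ∫⁻ ω, negExp (∑' i, f n (x i ω)) ∂P) atTop
      (𝓝 (∫⁻ ω, negExp (∑' i, φ (x i ω)) ∂P)) := by
    refine tendsto_lintegral_of_dominated_convergence (fun _ => 1)
      (fun n => measurable_negExp.comp
        (Measurable.tsum fun i => (f n).measurable.comp (hx.measurable i)))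
      (fun n => ae_of_all _ fun ω => negExp_le_one _) (by simp) (ae_of_all _ fun ω => ?_)
    exact (continuous_negExp.tendsto _).comp
      (tendsto_tsum_of_monotone (fun i => hf _) (fun i => hlim _))
  have h2 := tendsto_negExp_ofReal_mul
    (tendsto_lintegral_one_sub_negExp (fun n => (f n).measurable) hf hlim) lam
  refine tendsto_nhds_unique (h1.congr fun n => ?_) h2
  -- A simple function takes finitely many values, so its value serves as the label.
  exact hx.lintegral_negExp_tsum_label hlam (T := (f n).range)
    (lab := fun y => ⟨f n y, (f n).mem_range_self y⟩) ((f n).measurable.subtype_mk) Subtype.val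

lemma tsum_lintegral_indicator [Countable ι] (hx : IsPoissonPointProcess P x lam) (hlam : 0 ≤ lam)
    {C : Set Plane} (hC : MeasurableSet C) (hC' : volume C ≠ ∞) :
    ∑' i, ∫⁻ ω, C.indicator 1 (x i ω) ∂P = ENNReal.ofReal lam * volume C := by
  have hm : ∀ i, Measurable fun ω => C.indicator (1 : Plane → ℝ≥0∞) (x i ω) := fun i =>
    (measurable_one.indicator hC).comp (hx.measurable i)
  rw [← lintegral_tsum fun i => (hm i).aemeasurable]
  simp_rw [← countingMeasure_apply _ hC]
  -- With s = 0 the exponential factor is 1 and the mean count remains.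
  simpa using hx.lintegral_count_mul_negExp hlam hC hC' 0

/-! ### The Mecke formula for finitely many labels -/

section Labels

variable {T : Type*} [Fintype T] [MeasurableSpace T] [MeasurableSingletonClass T]
  {lab : Plane → T}

open Classical in
-- Removing a point with label t lowers the count of cell t by one and leaves the others alone. The
-- summand thus depends on i only through the indicator of label t, whose sum is N_t. Independence
-- gives a size-biased factor for cell t and Laplace factors for the other cells.
lemma tsum_lintegral_negExp_label_eq [IsProbabilityMeasure P] [Countable ι]
    (hx : IsPoissonPointProcess P x lam) (hlam : 0 ≤ lam) (hlab : Measurable lab) (c : T → ℝ≥0∞)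
    (t : T) (ht : volume (lab ⁻¹' {t}) ≠ ∞) :
    ∑' i, ∫⁻ ω, (if lab (x i ω) = t then 1 else 0) *
        negExp (∑' j : {j // j ≠ i}, c (lab (x j ω))) ∂P =
      ENNReal.ofReal lam * negExp (ENNReal.ofReal lam * ∫⁻ y, (1 - negExp (c (lab y)))) *
        volume (lab ⁻¹' {t}) := by
  have hm : ∀ t, MeasurableSet (lab ⁻¹' {t}) := fun t => hlab (measurableSet_singleton t)
  have hN : ∀ u ω, countingMeasure x ω (lab ⁻¹' {u}) =
      ∑' i, if lab (x i ω) = u then 1 else 0 := fun u ω => by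
    rw [countingMeasure_apply ω (hm u)]
    exact tsum_congr fun i => by simp [indicator_apply]
  let f : T → ℝ≥0∞ → ℝ≥0∞ := fun u n =>
    if u = t then n * negExp (c t * (n - 1)) else negExp (c u * n)
  have hf : ∀ u, Measurable (f u) := fun u => by
    by_cases hu : u = t
    · simp only [f, hu, if_true]
      exact measurable_id.mul (measurable_negExp.comp ((measurable_id.sub_const 1).const_mul _))
    · simp only [f, hu, if_false]
      exact measurable_negExp.comp (measurable_const_mul _)
  have h1 : ∀ ω i, (if lab (x i ω) = t then 1 else 0) *
      negExp (∑' j : {j // j ≠ i}, c (lab (x j ω))) =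
      (if lab (x i ω) = t then 1 else 0) *
        (negExp (c t * (countingMeasure x ω (lab ⁻¹' {t}) - 1)) *
          ∏ u ∈ Finset.univ.erase t, negExp (c u * countingMeasure x ω (lab ⁻¹' {u}))) := by
    intro ω i
    split_ifs with hi
    · rw [tsum_comp_eq_sum_mul_tsum c (fun j : {j // j ≠ i} => lab (x j ω)), negExp_sum,
        ← Finset.mul_prod_erase _ _ (Finset.mem_univ t)]
      congr 2
      -- The subtracted 1 is the contribution of the point i itself; cancelling it is valid even if
      -- the count is infinite.
      · rw [hN, tsum_eq_add_tsum_ne _ i, if_pos hi,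
          ENNReal.add_sub_cancel_left ENNReal.one_ne_top]
      · refine Finset.prod_congr rfl fun u hu => ?_
        have hu' : lab (x i ω) ≠ u := by rw [hi]; exact (Finset.ne_of_mem_erase hu).symm
        rw [hN, tsum_eq_add_tsum_ne _ i, if_neg hu', zero_add]
    · simp
  have hind : ∀ i, Measurable fun ω => if lab (x i ω) = t then (1 : ℝ≥0∞) else 0 := fun i =>
    Measurable.ite ((hlab.comp (hx.measurable i)) (measurableSet_singleton t))
      measurable_const measurable_const
  have hmeas : ∀ i, Measurable fun ω => (if lab (x i ω) = t then (1 : ℝ≥0∞) else 0) *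
        negExp (∑' j : {j // j ≠ i}, c (lab (x j ω))) := fun i =>
    (hind i).mul (measurable_negExp.comp (Measurable.tsum fun j =>
      Measurable.of_discrete.comp (hlab.comp (hx.measurable j))))
  rw [← lintegral_tsum fun i => (hmeas i).aemeasurable]
  have h2 : ∀ ω, ∑' i, (if lab (x i ω) = t then 1 else 0) *
      negExp (∑' j : {j // j ≠ i}, c (lab (x j ω))) =
      ∏ u, f u (countingMeasure x ω (lab ⁻¹' {u})) := by
    intro ω
    simp_rw [h1]
    rw [ENNReal.tsum_mul_right, ← hN, ← Finset.mul_prod_erase _ _ (Finset.mem_univ t), ← mul_assoc]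
    congr 1
    · simp [f]
    · exact Finset.prod_congr rfl fun u hu => by simp [f, Finset.ne_of_mem_erase hu]
  simp_rw [h2]
  rw [hx.lintegral_prod_count_label hlab hf, ← Finset.mul_prod_erase _ _ (Finset.mem_univ t)]
  simp only [f, if_true]
  rw [hx.lintegral_count_mul_negExp hlam (hm t) ht,
    lintegral_comp_label hlab volume (fun t => 1 - negExp (c t)), Finset.mul_sum, negExp_sum,
    ← Finset.mul_prod_erase _ _ (Finset.mem_univ t)]
  have h3 : ∏ u ∈ Finset.univ.erase t, ∫⁻ ω, (if u = t then
        countingMeasure x ω (lab ⁻¹' {u}) * negExp (c t * (countingMeasure x ω (lab ⁻¹' {u}) - 1))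
        else negExp (c u * countingMeasure x ω (lab ⁻¹' {u}))) ∂P =
      ∏ u ∈ Finset.univ.erase t,
        negExp (ENNReal.ofReal lam * ((1 - negExp (c u)) * volume (lab ⁻¹' {u}))) := by
    refine Finset.prod_congr rfl fun u hu => ?_
    simp only [Finset.ne_of_mem_erase hu, if_false]
    rw [hx.lintegral_negExp_mul_count hlam (hm u)]
    congr 1
    ring
  rw [h3, mul_comm (1 - negExp (c t)), ← mul_assoc (ENNReal.ofReal lam) (volume _)]
  ring

/-- The Mecke formula for functionals which see the points through finitely many labels. -/
lemma tsum_lintegral_negExp_label [IsProbabilityMeasure P] [Countable ι]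
    (hx : IsPoissonPointProcess P x lam) (hlam : 0 ≤ lam) (hlab : Measurable lab)
    (c : T → T → ℝ≥0∞) (s : Set T) (hs : ∀ t ∈ s, volume (lab ⁻¹' {t}) ≠ ∞) :
    ∑' i, ∫⁻ ω, (lab ⁻¹' s).indicator 1 (x i ω) *
        negExp (∑' j : {j // j ≠ i}, c (lab (x i ω)) (lab (x j ω))) ∂P =
      ∫⁻ z in lab ⁻¹' s, ENNReal.ofReal lam *
        negExp (ENNReal.ofReal lam * ∫⁻ y, (1 - negExp (c (lab z) (lab y)))) := by
  classical
  let F : T → ℝ≥0∞ := s.indicator fun t => ENNReal.ofReal lam *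
        negExp (ENNReal.ofReal lam * ∫⁻ y, (1 - negExp (c t (lab y))))
  have hR : ∫⁻ z in lab ⁻¹' s, ENNReal.ofReal lam *
        negExp (ENNReal.ofReal lam * ∫⁻ y, (1 - negExp (c (lab z) (lab y)))) =
      ∑ t, F t * volume (lab ⁻¹' {t}) := by
    rw [← lintegral_comp_label hlab, ← lintegral_indicator (hlab (Set.toFinite s).measurableSet)]
    rfl
  -- Splitting by the label t of x i freezes the first argument of c, which reduces to the one-label
  -- case.
  have hL : ∀ i ω, (lab ⁻¹' s).indicator 1 (x i ω) *
        negExp (∑' j : {j // j ≠ i}, c (lab (x i ω)) (lab (x j ω))) =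
      ∑ t, s.indicator 1 t * ((if lab (x i ω) = t then 1 else 0) *
        negExp (∑' j : {j // j ≠ i}, c t (lab (x j ω)))) := fun i ω => by
    rw [Finset.sum_eq_single (lab (x i ω)) (fun t _ ht => by simp [ht.symm]) (by simp)]
    simp [indicator_apply]
  have hmeas : ∀ i t, Measurable fun ω => (if lab (x i ω) = t then (1 : ℝ≥0∞) else 0) *
        negExp (∑' j : {j // j ≠ i}, c t (lab (x j ω))) := fun i t =>
    (Measurable.ite ((hlab.comp (hx.measurable i)) (measurableSet_singleton t))
      measurable_const measurable_const).mul (measurable_negExp.comp (Measurable.tsum fun j =>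
    Measurable.of_discrete.comp (hlab.comp (hx.measurable j))))
  simp_rw [hL]
  have hI : ∀ i, ∫⁻ ω, ∑ t, s.indicator 1 t * ((if lab (x i ω) = t then 1 else 0) *
        negExp (∑' j : {j // j ≠ i}, c t (lab (x j ω)))) ∂P =
      ∑ t, s.indicator 1 t * ∫⁻ ω, ((if lab (x i ω) = t then 1 else 0) *
        negExp (∑' j : {j // j ≠ i}, c t (lab (x j ω)))) ∂P := fun i => by
    rw [lintegral_finsetSum _ fun t _ => (hmeas i t).const_mul _]
    exact Finset.sum_congr rfl fun t _ => lintegral_const_mul _ (hmeas i t)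
  simp_rw [hI]
  rw [Summable.tsum_finsetSum fun _ _ => ENNReal.summable, hR]
  refine Finset.sum_congr rfl fun t _ => ?_
  rw [ENNReal.tsum_mul_left]
  by_cases ht : t ∈ s
  · simp only [F, indicator_of_mem ht, Pi.one_apply, one_mul]
    exact hx.tsum_lintegral_negExp_label_eq hlam hlab (c t) t (hs t ht)
  · simp [F, ht]

end Labels

end IsPoissonPointProcess

/-! ### The Mecke formula for lower semicontinuous kernels -/

/-- A lower semicontinuous function on a product is a countable supremum of multiples of indicators
of open rectangles. -/
lemma exists_iSup_indicator_eq {X : Type*} [TopologicalSpace X] [SecondCountableTopology X]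
    [Nonempty X] {φ : X → X → ℝ≥0∞} (hφ : LowerSemicontinuous (Function.uncurry φ)) :
    ∃ (U V : ℕ → Set X) (c : ℕ → ℝ≥0∞), (∀ m, IsOpen (U m)) ∧ (∀ m, IsOpen (V m)) ∧
      ∀ x y, φ x y = ⨆ m, (U m ×ˢ V m).indicator (fun _ => c m) (x, y) := by
  classical
  let b := TopologicalSpace.countableBasis X
  have hb : TopologicalSpace.IsTopologicalBasis b := TopologicalSpace.isBasis_countableBasis X
  obtain ⟨B₀, hB₀, -⟩ := hb.exists_subset_of_mem_open (mem_univ (Classical.arbitrary X)) isOpen_univ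
  have : Nonempty b := ⟨⟨B₀, hB₀⟩⟩
  have : Countable b := (TopologicalSpace.countable_countableBasis X).to_subtype
  obtain ⟨e, he⟩ := exists_surjective_nat (b × b × ℚ)
  let r : ℚ → ℝ≥0∞ := fun q => ((Real.toNNReal q : ℝ≥0) : ℝ≥0∞)
  -- A basic rectangle keeps its rational weight only where that is a lower bound for φ; otherwise
  -- its weight is 0. Lower semicontinuity makes the good rectangles reach every value below φ x y.
  let good : ℕ → Prop := fun m => ∀ x ∈ ((e m).1 : Set X), ∀ y ∈ ((e m).2.1 : Set X),
    r (e m).2.2 ≤ φ x y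
  refine ⟨fun m => (e m).1, fun m => (e m).2.1, fun m => if good m then r (e m).2.2 else 0,
    fun m => hb.isOpen (e m).1.2, fun m => hb.isOpen (e m).2.1.2, fun x y => le_antisymm ?_ ?_⟩
  · refine le_of_forall_lt fun a ha => ?_
    obtain ⟨q, -, haq, hq⟩ := ENNReal.lt_iff_exists_rat_btwn.1 ha
    have hopen : IsOpen (Function.uncurry φ ⁻¹' Ioi (r q)) := hφ.isOpen_preimage _
    obtain ⟨u, v, hu, hv, hxu, hyv, huv⟩ := isOpen_prod_iff.1 hopen x y hq
    obtain ⟨u', hu', hxu', huu'⟩ := hb.exists_subset_of_mem_open hxu hu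
    obtain ⟨v', hv', hyv', hvv'⟩ := hb.exists_subset_of_mem_open hyv hv
    obtain ⟨m, hm⟩ := he (⟨u', hu'⟩, ⟨v', hv'⟩, q)
    have hg : good m := by
      simp only [good, hm]
      intro x' hx' y' hy'
      exact (huv (mk_mem_prod (huu' hx') (hvv' hy'))).le
    refine lt_of_lt_of_le haq (le_iSup_of_le m ?_)
    simp only [if_pos hg, hm]
    rw [indicator_of_mem (show (x, y) ∈ u' ×ˢ v' from ⟨hxu', hyv'⟩)]
  · refine iSup_le fun m => ?_
    by_cases h1 : (x, y) ∈ ((e m).1 : Set X) ×ˢ ((e m).2.1 : Set X)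
    · rw [indicator_of_mem h1]
      dsimp only
      split_ifs with h2
      · exact h2 x h1.1 y h1.2
      · exact zero_le
    · rw [indicator_of_notMem h1]
      exact zero_le

namespace IsPoissonPointProcess

variable {Ω ι : Type*} {x : ι → Ω → Plane} {lam : ℝ} [MeasurableSpace Ω] {P : Measure Ω}

/-- The Mecke formula for `exp (-∑ φ (xᵢ, xⱼ))`, where `φ` is lower semicontinuous. -/
theorem tsum_lintegral_negExp [IsProbabilityMeasure P] [Countable ι]
    (hx : IsPoissonPointProcess P x lam) (hlam : 0 ≤ lam) {φ : Plane → Plane → ℝ≥0∞}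
    (hφ : LowerSemicontinuous (Function.uncurry φ)) {C : Set Plane} (hC : MeasurableSet C)
    (hC' : volume C ≠ ∞) :
    ∑' i, ∫⁻ ω, C.indicator 1 (x i ω) *
        negExp (∑' j : {j // j ≠ i}, φ (x i ω) (x j ω)) ∂P =
      ∫⁻ z in C, ENNReal.ofReal lam *
        negExp (ENNReal.ofReal lam * ∫⁻ y, (1 - negExp (φ z y))) := by
  classical
  obtain ⟨U, V, c, hU, hV, hUV⟩ := exists_iSup_indicator_eq hφ
  let f : ℕ → Plane → Plane → ℝ≥0∞ := fun n z y =>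
    ⨆ m : Fin n, (U m ×ˢ V m).indicator (fun _ => c m) (z, y)
  have hmono : ∀ z y, Monotone fun n => f n z y := fun z y m n h =>
    iSup_le fun k => le_iSup (fun m : Fin n => (U m ×ˢ V m).indicator (fun _ => c m) (z, y))
      ⟨k, k.2.trans_le h⟩
  have hlim : ∀ z y, Tendsto (fun n => f n z y) atTop (𝓝 (φ z y)) := fun z y => by
    have : φ z y = ⨆ n, f n z y := by
      rw [hUV]
      refine le_antisymm (iSup_le fun m => le_iSup_of_le (m + 1) ?_)
        (iSup_le fun n => iSup_le fun m => le_iSup_of_le (m : ℕ) le_rfl)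
      exact le_iSup (fun m : Fin _ => (U m ×ˢ V m).indicator (fun _ => c m) (z, y))
        ⟨m, m.lt_succ_self⟩
    rw [this]
    exact tendsto_atTop_iSup (hmono z y)
  have hmeas : ∀ n, Measurable (Function.uncurry (f n)) := fun n =>
    Measurable.iSup fun m => measurable_const.indicator
      ((hU m).measurableSet.prod (hV m).measurableSet)
  have hmL : ∀ n i, Measurable fun ω => C.indicator (1 : Plane → ℝ≥0∞) (x i ω) *
      negExp (∑' j : {j // j ≠ i}, f n (x i ω) (x j ω)) := fun n i =>
    ((measurable_one.indicator hC).comp (hx.measurable i)).mul (measurable_negExp.comp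
      (Measurable.tsum fun j => (hmeas n).comp ((hx.measurable i).prodMk (hx.measurable j))))
  have hle : ∀ (z : Plane) (a : ℝ≥0∞), C.indicator (1 : Plane → ℝ≥0∞) z * negExp a ≤
      C.indicator 1 z := fun z a => mul_le_of_le_one_right' (negExp_le_one a)
  -- The exponentials decrease in n, so the limit needs domination. The bound is the number of
  -- points in C, of finite mean since C has finite area.
  have hfin : ∑' i, ∫⁻ ω, C.indicator 1 (x i ω) ∂P ≠ ∞ := by
    rw [hx.tsum_lintegral_indicator hlam hC hC']
    exact ENNReal.mul_ne_top ENNReal.ofReal_ne_top hC'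
  have h1 : Tendsto (fun n => ∑' i, ∫⁻ ω, C.indicator 1 (x i ω) *
        negExp (∑' j : {j // j ≠ i}, f n (x i ω) (x j ω)) ∂P) atTop
      (𝓝 (∑' i, ∫⁻ ω, C.indicator 1 (x i ω) *
        negExp (∑' j : {j // j ≠ i}, φ (x i ω) (x j ω)) ∂P)) := by
    refine tendsto_tsum_of_dominated hfin (fun n i => lintegral_mono fun ω => hle _ _)
      fun i => ?_
    refine tendsto_lintegral_of_dominated_convergence (fun ω => C.indicator 1 (x i ω))
      (fun n => hmL n i) (fun n => ae_of_all _ fun ω => hle _ _)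
      (ENNReal.ne_top_of_tsum_ne_top hfin i) (ae_of_all _ fun ω => ?_)
    refine ENNReal.Tendsto.const_mul ((continuous_negExp.tendsto _).comp
      (tendsto_tsum_of_monotone (fun j => hmono _ _) fun j => hlim _ _)) (.inr ?_)
    by_cases h : x i ω ∈ C <;> simp [h]
  have h2 : Tendsto (fun n => ∫⁻ z in C, ENNReal.ofReal lam *
        negExp (ENNReal.ofReal lam * ∫⁻ y, (1 - negExp (f n z y)))) atTop
      (𝓝 (∫⁻ z in C, ENNReal.ofReal lam *
        negExp (ENNReal.ofReal lam * ∫⁻ y, (1 - negExp (φ z y))))) := by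
    refine tendsto_lintegral_of_dominated_convergence (fun _ => ENNReal.ofReal lam)
      (fun n => ?_) (fun n => ae_of_all _ fun z => mul_le_of_le_one_right' (negExp_le_one _))
      (by simp [ENNReal.mul_eq_top, hC']) (ae_of_all _ fun z => ?_)
    · refine (measurable_negExp.comp (Measurable.const_mul ?_ _)).const_mul _
      exact Measurable.lintegral_prod_right'
        (f := fun p : Plane × Plane => 1 - negExp (Function.uncurry (f n) p))
        (measurable_const.sub (measurable_negExp.comp (hmeas n)))
    · refine ENNReal.Tendsto.const_mul ?_ (.inr ENNReal.ofReal_ne_top)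
      exact tendsto_negExp_ofReal_mul (tendsto_lintegral_one_sub_negExp
        (fun n => (hmeas n).comp measurable_prodMk_left) (hmono z) (hlim z)) lam
  refine tendsto_nhds_unique (h1.congr fun n => ?_) h2
  -- Membership in the first n rectangle sides and in C: finitely many labels, which determine f n
  -- and the restriction to C. Labels with last entry true have cells inside C, hence of finite
  -- area.
  let lab : Plane → (Fin n → Prop × Prop) × Prop := fun y => (fun m => (y ∈ U m, y ∈ V m), y ∈ C)
  have hlab : Measurable lab := by
    refine Measurable.prodMk (measurable_pi_lambda _ fun m => Measurable.prodMk ?_ ?_) ?_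
    · exact measurableSet_setOfPred.1 (hU m).measurableSet
    · exact measurableSet_setOfPred.1 (hV m).measurableSet
    · exact measurableSet_setOfPred.1 hC
  have hf : ∀ z y, f n z y = ⨆ m : Fin n,
      if ((lab z).1 m).1 ∧ ((lab y).1 m).2 then c m else 0 := fun z y => by
    simp only [f, indicator_apply, lab, mem_prod]
  simp_rw [hf]
  exact hx.tsum_lintegral_negExp_label hlam hlab
    (fun t u => ⨆ m : Fin n, if (t.1 m).1 ∧ (u.1 m).2 then c m else 0) {t | t.2}
    fun t ht => ne_top_of_le_ne_top hC' (measure_mono fun y hy => by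
      have h : (lab y).2 = t.2 := by rw [show lab y = t from hy]
      exact (iff_of_eq h).2 ht)

end IsPoissonPointProcess

/-! ### Independence tools -/

section Independence

variable {Ω : Type*} [MeasurableSpace Ω] {P : Measure Ω}

lemma lintegral_comp_prodMk_of_indepFun {α β : Type*} [MeasurableSpace α] [MeasurableSpace β]
    [IsProbabilityMeasure P] {X : Ω → α} {Y : Ω → β} (hX : Measurable X) (hY : Measurable Y)
    (h : IndepFun X Y P) {F : α × β → ℝ≥0∞} (hF : Measurable F) :
    ∫⁻ ω, F (X ω, Y ω) ∂P = ∫⁻ ω, ∫⁻ ω', F (X ω, Y ω') ∂P ∂P := by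
  have hX' : IsProbabilityMeasure (P.map X) := Measure.isProbabilityMeasure_map hX.aemeasurable
  have hY' : IsProbabilityMeasure (P.map Y) := Measure.isProbabilityMeasure_map hY.aemeasurable
  have h1 := (indepFun_iff_map_prod_eq_prod_map_map hX.aemeasurable hY.aemeasurable).1 h
  rw [← lintegral_map hF (hX.prodMk hY), h1, lintegral_prod _ hF.aemeasurable,
    lintegral_map hF.lintegral_prod_right' hX]
  exact lintegral_congr fun ω => lintegral_map (hF.comp measurable_prodMk_left) hY

/-- The probability that none of countably many independent events happens. -/
lemma measure_iInter_compl_of_iIndepSet {K : Type*} [Countable K] [IsProbabilityMeasure P]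
    {A : K → Set Ω} (hA : ∀ a, MeasurableSet (A a)) (h : iIndepSet A P) :
    P (⋂ a, (A a)ᶜ) = negExp (∑' a, negLogOneSub (P (A a))) := by
  have hfin : ∀ s : Finset K, P (⋂ a ∈ s, (A a)ᶜ) =
      negExp (∑ a ∈ s, negLogOneSub (P (A a))) := fun s => by
    rw [negExp_sum]
    simp_rw [negExp_negLogOneSub, ← prob_compl_eq_one_sub (hA _)]
    refine iIndep.meas_biInter h fun a _ => ?_
    exact MeasurableSet.compl (MeasurableSpace.measurableSet_generateFrom (mem_singleton _))
  have h1 : Tendsto (fun s : Finset K => P (⋂ a ∈ s, (A a)ᶜ)) atTop (𝓝 (P (⋂ a, (A a)ᶜ))) := by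
    have := tendsto_measure_iInter_atTop (μ := P) (s := fun s : Finset K => ⋂ a ∈ s, (A a)ᶜ)
      (fun s => (Finset.measurableSet_biInter s fun a _ => (hA a).compl).nullMeasurableSet)
      (fun s t hst => biInter_subset_biInter_left hst) ⟨∅, measure_ne_top _ _⟩
    rwa [← iInter_eq_iInter_finset] at this
  have h2 : Tendsto (fun s : Finset K => negExp (∑ a ∈ s, negLogOneSub (P (A a)))) atTop
      (𝓝 (negExp (∑' a, negLogOneSub (P (A a))))) :=
    (continuous_negExp.tendsto _).comp ENNReal.summable.hasSum
  exact tendsto_nhds_unique (h1.congr hfin) h2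

/-- Events determined by disjoint finite blocks of independent variables are independent. -/
lemma iIndepSet_biInter_preimage {K M : Type*} [DecidableEq M] {X : M → Ω → ℝ} (h : iIndepFun X P)
    (hX : ∀ m, Measurable (X m)) {D : M → Set ℝ} (hD : ∀ m, MeasurableSet (D m))
    {g : K → Finset M} (hg : Pairwise fun a b => Disjoint (g a) (g b)) :
    iIndepSet (fun a => ⋂ m ∈ g a, X m ⁻¹' D m) P := by
  have key : ∀ s : Finset M, P (⋂ m ∈ s, X m ⁻¹' D m) = ∏ m ∈ s, P (X m ⁻¹' D m) := fun s =>
    h.measure_inter_preimage_eq_mul s fun m _ => hD m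
  rw [iIndepSet_iff_meas_biInter fun a => Finset.measurableSet_biInter _ fun m _ => hX m (hD m)]
  intro s
  rw [← Finset.set_biInter_biUnion, key, Finset.prod_biUnion fun a _ b _ hab => hg hab]
  exact Finset.prod_congr rfl fun a _ => (key _).symm

/-- Overwriting one coordinate by a constant keeps the index type while leaving a family that
depends only on the other, independent variables. -/
lemma indepFun_update {M : Type*} [DecidableEq M] {X : M → Ω → ℝ} (h : iIndepFun X P)
    (hX : ∀ m, Measurable (X m)) (m₀ : M) :
    IndepFun (X m₀) (fun ω => Function.update (fun m => X m ω) m₀ 0) P := by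
  have h1 := indep_iSup_of_disjoint (fun m => (hX m).comap_le) h
    (disjoint_compl_right (a := ({m₀} : Set M)))
  rw [IndepFun_iff_Indep]
  refine indep_of_indep_of_le_left (indep_of_indep_of_le_right h1 ?_) ?_
  · rw [← measurable_iff_comap_le]
    refine (@measurable_pi_iff _ _ _ (_) _ _).2 fun m => ?_
    by_cases hm : m = m₀
    · subst hm
      simp only [Function.update_self]
      exact @measurable_const _ _ _ (_) _
    · simp only [Function.update_of_ne hm]
      rw [measurable_iff_comap_le]
      exact le_iSup₂_of_le m hm le_rfl
  · exact le_iSup₂_of_le m₀ rfl le_rfl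

end Independence

/-! ### Detection probabilities -/

/-- The probability that a transmission of power `pow` is detected over the displacement `z` with
the threshold `thr`. At `z = 0` the path loss vanishes and the detection event is empty. -/
def Parameters.detectProb (q : Parameters) (pow thr : ℝ) (z : Plane) : ℝ≥0∞ :=
  if z = 0 then 0 else ENNReal.ofReal (Real.exp (-q.mu * (thr / pow) * q.pathLoss ‖z‖))

lemma Parameters.pathLoss_zero (q : Parameters) : q.pathLoss 0 = 0 := by
  simp [pathLoss, Real.zero_rpow q.alpha_pos.ne']

lemma Parameters.pathLoss_pos (q : Parameters) {d : ℝ} (hd : 0 < d) : 0 < q.pathLoss d := by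
  have := q.wavelength_pos
  have := Real.rpow_pos_of_pos hd q.alpha
  unfold pathLoss
  positivity

lemma Parameters.pathLoss_nonneg (q : Parameters) {d : ℝ} (hd : 0 ≤ d) : 0 ≤ q.pathLoss d := by
  unfold pathLoss
  positivity

lemma Parameters.continuous_pathLoss (q : Parameters) : Continuous q.pathLoss :=
  continuous_const.mul (Real.continuous_rpow_const q.alpha_pos.le)

lemma Parameters.detectProb_le_one (q : Parameters) {pow thr : ℝ} (hpow : 0 < pow) (hthr : 0 < thr)
    (z : Plane) : q.detectProb pow thr z ≤ 1 := by
  unfold detectProb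
  split_ifs
  · exact zero_le
  · have h1 := q.pathLoss_nonneg (norm_nonneg z)
    have h2 := q.mu_pos
    rw [← ENNReal.ofReal_one]
    refine ENNReal.ofReal_le_ofReal (Real.exp_le_one_iff.2 ?_)
    have : 0 ≤ q.mu * (thr / pow) * q.pathLoss ‖z‖ := by positivity
    linarith

/-- Away from the origin the function is continuous; at the origin it takes its least value 0, so
the jump there does no harm. -/
lemma Parameters.lowerSemicontinuous_detectProb (q : Parameters) (pow thr : ℝ) :
    LowerSemicontinuous (q.detectProb pow thr) := by
  intro z
  by_cases hz : z = 0
  · intro a ha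
    simp [detectProb, hz] at ha
  · have hc : Continuous fun z : Plane =>
        ENNReal.ofReal (Real.exp (-q.mu * (thr / pow) * q.pathLoss ‖z‖)) := by
      have := q.continuous_pathLoss
      exact ENNReal.continuous_ofReal.comp (by fun_prop)
    have : q.detectProb pow thr =ᶠ[𝓝 z] fun z =>
        ENNReal.ofReal (Real.exp (-q.mu * (thr / pow) * q.pathLoss ‖z‖)) := by
      filter_upwards [isOpen_ne.mem_nhds hz] with y hy
      exact if_neg hy
    exact (hc.continuousAt.congr this.symm).lowerSemicontinuousAt

/-- The exponential tail for z ≠ 0. At z = 0 the quotient g / 0 is 0 by convention, hence below the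
positive threshold, which explains the value 0 there. -/
lemma Parameters.expMeasure_detect (q : Parameters) {pow thr : ℝ} (hpow : 0 < pow) (hthr : 0 < thr)
    (z : Plane) :
    expMeasure q.mu {g | g / q.pathLoss ‖z‖ ≤ thr / pow}ᶜ = q.detectProb pow thr z := by
  unfold detectProb
  split_ifs with hz
  · have : {g : ℝ | g / q.pathLoss ‖z‖ ≤ thr / pow} = univ := by
      simp [hz, q.pathLoss_zero, (div_pos hthr hpow).le]
    simp [this]
  · have hl := q.pathLoss_pos (norm_pos_iff.2 hz)
    have hs : {g : ℝ | g / q.pathLoss ‖z‖ ≤ thr / pow} = Iic (thr / pow * q.pathLoss ‖z‖) := by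
      ext g
      simp [div_le_iff₀ hl]
    have hprob := isProbabilityMeasure_expMeasure q.mu_pos
    have hnn : 0 ≤ thr / pow * q.pathLoss ‖z‖ := by positivity
    rw [hs, ← ofReal_measureReal, measureReal_compl measurableSet_Iic, probReal_univ,
      ← cdf_eq_real, cdf_expMeasure_eq q.mu_pos, if_pos hnn]
    congr 1
    rw [sub_sub_cancel]
    congr 1
    ring

/-- An infinite product of indicators is the indicator of the conjunction. -/
lemma tprod_ite_one_zero {J : Type*} (p : J → Prop) [DecidablePred p]
    [Decidable (∀ j, p j)] :
    (∏' j, if p j then (1 : ℝ) else 0) = if ∀ j, p j then 1 else 0 := by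
  split_ifs with h
  · simp [h]
  · push Not at h
    obtain ⟨j, hj⟩ := h
    exact (hasProd_zero_of_exists_eq_zero ⟨j, if_neg hj⟩).tprod_eq

/-! ### Access probability given the locations -/

namespace Network

variable {Ω ι κ : Type*}

lemma accessIndicator_eq_one_iff (S : Network Ω ι κ) (q : Parameters) (i : ι) (ω : Ω) :
    S.accessIndicator q i ω = 1 ↔
      (∀ k, S.fadLW k i ω / q.pathLoss ‖S.enb k ω - S.ap i ω‖ ≤ q.thrED / q.powL) ∧
      ∀ j : {j // j ≠ i}, S.timer i ω ≤ S.timer j ω ∨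
        S.fadW j i ω / q.pathLoss ‖S.ap j ω - S.ap i ω‖ ≤ q.thrCS / q.powW := by
  classical
  have h1 : ∀ j : {j // j ≠ i}, ((if S.timer j ω ≥ S.timer i ω then (1 : ℝ) else 0) +
      (if S.timer j ω < S.timer i ω then 1 else 0) *
      (if S.fadW j i ω / q.pathLoss ‖S.ap j ω - S.ap i ω‖ ≤ q.thrCS / q.powW then 1 else 0)) =
      if S.timer i ω ≤ S.timer j ω ∨
        S.fadW j i ω / q.pathLoss ‖S.ap j ω - S.ap i ω‖ ≤ q.thrCS / q.powW then 1 else 0 := by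
    intro j
    by_cases h : S.timer i ω ≤ S.timer j ω
    · simp [h, not_lt.2 h]
    · simp [h, not_le.1 h]
  unfold accessIndicator
  simp_rw [h1, tprod_ite_one_zero]
  split_ifs <;> simp_all

variable [MeasurableSpace Ω] {P : Measure Ω} {S : Network Ω ι κ} {q : Parameters}

namespace IsModel

lemma map_timer (hS : S.IsModel q P) (i : ι) : P.map (S.timer i) = volume.restrict (Icc 0 1) := by
  have := hS.timer_uniform i
  rw [pdf.IsUniform, ProbabilityTheory.cond] at this
  simpa using this

lemma measure_timer_lt (hS : S.IsModel q P) (j : ι) (t : ℝ) :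
    P (S.timer j ⁻¹' Iio t) = min (ENNReal.ofReal t) 1 := by
  have hm : Measurable (S.timer j) := hS.measurable_marks (Sum.inl j)
  rw [← Measure.map_apply hm measurableSet_Iio, hS.map_timer,
    Measure.restrict_apply measurableSet_Iio]
  rcases le_or_gt t 1 with ht | ht
  · have : Iio t ∩ Icc 0 1 = Ico 0 t := by
      ext u
      simp only [mem_inter_iff, mem_Iio, mem_Icc, mem_Ico]
      constructor
      · rintro ⟨h1, h2, h3⟩; exact ⟨h2, h1⟩
      · rintro ⟨h1, h2⟩; exact ⟨h2, h1, h2.le.trans ht⟩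
    rw [this, Real.volume_Ico, sub_zero, min_eq_left (by simpa using ht)]
  · have : Iio t ∩ Icc 0 1 = Icc 0 1 := inter_eq_right.2 fun u hu => hu.2.trans_lt ht
    rw [this, Real.volume_Icc, sub_zero, ENNReal.ofReal_one, min_eq_right (by simpa using ht.le)]

/-- With the timer of i replaced by a constant t, the blocking events use disjoint sets of marks:
one fading per eNB, a timer and a fading per other AP. The `min` makes the formula hold for every
real t. -/
lemma measure_access_timer_eq [Countable ι] [Countable κ] [IsProbabilityMeasure P]
    (hS : S.IsModel q P) (i : ι) (t : ℝ) (z : κ → Plane) (w : {j // j ≠ i} → Plane) :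
    P {ω | (∀ k, S.fadLW k i ω / q.pathLoss ‖z k‖ ≤ q.thrED / q.powL) ∧
        ∀ j : {j // j ≠ i}, t ≤ S.timer j ω ∨
          S.fadW j i ω / q.pathLoss ‖w j‖ ≤ q.thrCS / q.powW} =
      negExp (∑' k, negLogOneSub (q.detectProb q.powL q.thrED (z k))) *
        negExp (∑' j, negLogOneSub
          (min (ENNReal.ofReal t) 1 * q.detectProb q.powW q.thrCS (w j))) := by
  classical
  let D : ι ⊕ (ι × ι) ⊕ (κ × ι) → Set ℝ
    | Sum.inl _ => Iio t
    | Sum.inr (Sum.inl (j, _)) =>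
        if h : j ≠ i then {g | g / q.pathLoss ‖w ⟨j, h⟩‖ ≤ q.thrCS / q.powW}ᶜ else ∅
    | Sum.inr (Sum.inr (k, _)) => {g | g / q.pathLoss ‖z k‖ ≤ q.thrED / q.powL}ᶜ
  have hle : ∀ c θ : ℝ, MeasurableSet {g : ℝ | g / c ≤ θ} := fun c θ =>
    measurableSet_le (measurable_id.div_const c) measurable_const
  have hD : ∀ m, MeasurableSet (D m) := by
    rintro (j | ⟨j, j'⟩ | ⟨k, j'⟩)
    · exact measurableSet_Iio
    · simp only [D]
      split_ifs
      · exact (hle _ _).compl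
      · exact MeasurableSet.empty
    · exact (hle _ _).compl
  let g : κ ⊕ {j // j ≠ i} → Finset (ι ⊕ (ι × ι) ⊕ (κ × ι))
    | Sum.inl k => {Sum.inr (Sum.inr (k, i))}
    | Sum.inr j => {Sum.inl (j : ι), Sum.inr (Sum.inl ((j : ι), i))}
  have hg : Pairwise fun a b => Disjoint (g a) (g b) := by
    rintro (k | j) (k' | j') hab
    · simpa [g] using fun h => hab (by rw [h])
    · simp [g]
    · simp [g]
    · have : (j : ι) ≠ j' := fun h => hab (by rw [Subtype.ext h])
      simp [g, this.symm]
  have hind := iIndepSet_biInter_preimage hS.indep_marks hS.measurable_marks hD hg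
  have hmeas : ∀ a, MeasurableSet (⋂ m ∈ g a, S.marks m ⁻¹' D m) := fun a =>
    Finset.measurableSet_biInter _ fun m _ => hS.measurable_marks m (hD m)
  have hgL : ∀ k, ⋂ m ∈ g (Sum.inl k), S.marks m ⁻¹' D m =
      S.fadLW k i ⁻¹' {g | g / q.pathLoss ‖z k‖ ≤ q.thrED / q.powL}ᶜ := fun k => by
    simp [g, D, marks]
  have hgR : ∀ j, ⋂ m ∈ g (Sum.inr j), S.marks m ⁻¹' D m = S.timer j ⁻¹' Iio t ∩
      S.fadW j i ⁻¹' {g | g / q.pathLoss ‖w j‖ ≤ q.thrCS / q.powW}ᶜ := fun j => by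
    simp [g, D, marks, j.2]
  have hset : {ω | (∀ k, S.fadLW k i ω / q.pathLoss ‖z k‖ ≤ q.thrED / q.powL) ∧
        ∀ j : {j // j ≠ i}, t ≤ S.timer j ω ∨
          S.fadW j i ω / q.pathLoss ‖w j‖ ≤ q.thrCS / q.powW} =
      ⋂ a, (⋂ m ∈ g a, S.marks m ⁻¹' D m)ᶜ := by
    ext ω
    rw [mem_iInter, Sum.forall]
    refine and_congr (forall_congr' fun k => ?_) (forall_congr' fun j => ?_)
    · rw [hgL]
      simp
    · rw [hgR]
      simp [imp_iff_not_or]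
  have hmL : ∀ k, Measurable (S.fadLW k i) := fun k =>
    hS.measurable_marks (Sum.inr (Sum.inr (k, i)))
  have hmW : ∀ j, Measurable (S.fadW j i) := fun j =>
    hS.measurable_marks (Sum.inr (Sum.inl (j, i)))
  have hpair : ∀ j : {j // j ≠ i}, IndepFun (S.timer j) (S.fadW j i) P := fun j =>
    hS.indep_marks.indepFun (i := Sum.inl (j : ι)) (j := Sum.inr (Sum.inl ((j : ι), i))) (by simp)
  rw [hset, measure_iInter_compl_of_iIndepSet hmeas hind,
    ENNReal.summable.tsum_sum ENNReal.summable, negExp_add]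
  simp_rw [hgL, hgR]
  congr 2
  · refine tsum_congr fun k => congrArg _ ?_
    rw [← q.expMeasure_detect q.powL_pos q.thrED_pos, ← (hS.fadLW_exp k i).map_eq,
      Measure.map_apply (hmL k) (hle _ _).compl]
  · refine tsum_congr fun j => congrArg _ ?_
    rw [← q.expMeasure_detect q.powW_pos q.thrCS_pos, ← (hS.fadW_exp j i).map_eq,
      Measure.map_apply (hmW j) (hle _ _).compl, ← hS.measure_timer_lt j t]
    exact (hpair j).measure_inter_preimage_eq_mul _ _ measurableSet_Iio (hle _ _).compl

/-- The probability of medium access of the AP `i` given the displacements of all transmitters. -/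
lemma measure_access [Countable ι] [Countable κ] [IsProbabilityMeasure P]
    (hS : S.IsModel q P) (i : ι) (z : κ → Plane) (w : {j // j ≠ i} → Plane) :
    P {ω | (∀ k, S.fadLW k i ω / q.pathLoss ‖z k‖ ≤ q.thrED / q.powL) ∧
        ∀ j : {j // j ≠ i}, S.timer i ω ≤ S.timer j ω ∨
          S.fadW j i ω / q.pathLoss ‖w j‖ ≤ q.thrCS / q.powW} =
      negExp (∑' k, negLogOneSub (q.detectProb q.powL q.thrED (z k))) *
        ∫⁻ t in Icc (0 : ℝ) 1, negExp (∑' j, negLogOneSub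
          (ENNReal.ofReal t * q.detectProb q.powW q.thrCS (w j))) := by
  classical
  let E : Set (ℝ × (ι ⊕ (ι × ι) ⊕ (κ × ι) → ℝ)) :=
    (⋂ k, {p | p.2 (Sum.inr (Sum.inr (k, i))) / q.pathLoss ‖z k‖ ≤ q.thrED / q.powL}) ∩
    ⋂ j : {j // j ≠ i}, ({p | p.1 ≤ p.2 (Sum.inl (j : ι))} ∪
      {p | p.2 (Sum.inr (Sum.inl ((j : ι), i))) / q.pathLoss ‖w j‖ ≤ q.thrCS / q.powW})
  have hE : MeasurableSet E := by
    refine (MeasurableSet.iInter fun k => ?_).inter (MeasurableSet.iInter fun j =>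
      MeasurableSet.union ?_ ?_)
    · exact measurableSet_le (by fun_prop) (by fun_prop)
    · exact measurableSet_le (by fun_prop) (by fun_prop)
    · exact measurableSet_le (by fun_prop) (by fun_prop)
  -- The event `E` never reads the timer of i from its second argument, since j ≠ i; overwriting it
  -- changes nothing and makes `Y` independent of that timer.
  let Y : Ω → ι ⊕ (ι × ι) ⊕ (κ × ι) → ℝ := fun ω =>
    Function.update (fun m => S.marks m ω) (Sum.inl i) 0
  have hY : Measurable Y := measurable_pi_iff.2 fun m => by
    by_cases hm : m = Sum.inl i
    · subst hm
      simp [Y]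
    · simpa [Y, Function.update_of_ne hm] using hS.measurable_marks m
  have hmem : ∀ t ω, (t, Y ω) ∈ E ↔
      (∀ k, S.fadLW k i ω / q.pathLoss ‖z k‖ ≤ q.thrED / q.powL) ∧
        ∀ j : {j // j ≠ i}, t ≤ S.timer j ω ∨
          S.fadW j i ω / q.pathLoss ‖w j‖ ≤ q.thrCS / q.powW := fun t ω => by
    simp only [E, Y, mem_inter_iff, mem_iInter, mem_union, mem_ofPred_eq]
    refine and_congr (forall_congr' fun k => ?_) (forall_congr' fun j => ?_)
    · simp [marks]
    · rw [Function.update_of_ne (by simpa using j.2), Function.update_of_ne (by simp)]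
      rfl
  have hT : Measurable (S.timer i) := hS.measurable_marks (Sum.inl i)
  have hsec : ∀ t, MeasurableSet {ω | (t, Y ω) ∈ E} := fun t =>
    (measurable_const.prodMk hY) hE
  have h1 := lintegral_comp_prodMk_of_indepFun hT hY
    (indepFun_update hS.indep_marks hS.measurable_marks (Sum.inl i))
    (F := E.indicator 1) (measurable_one.indicator hE)
  have h2 : ∫⁻ ω, E.indicator 1 (S.timer i ω, Y ω) ∂P =
      P {ω | (∀ k, S.fadLW k i ω / q.pathLoss ‖z k‖ ≤ q.thrED / q.powL) ∧
        ∀ j : {j // j ≠ i}, S.timer i ω ≤ S.timer j ω ∨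
          S.fadW j i ω / q.pathLoss ‖w j‖ ≤ q.thrCS / q.powW} := by
    have : MeasurableSet {ω | (S.timer i ω, Y ω) ∈ E} := (hT.prodMk hY) hE
    simp_rw [← hmem]
    rw [← lintegral_indicator_one this]
    rfl
  have h3 : ∀ t, ∫⁻ ω, E.indicator 1 (t, Y ω) ∂P =
      negExp (∑' k, negLogOneSub (q.detectProb q.powL q.thrED (z k))) *
        negExp (∑' j, negLogOneSub
          (min (ENNReal.ofReal t) 1 * q.detectProb q.powW q.thrCS (w j))) := fun t => by
    rw [← hS.measure_access_timer_eq i t z w]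
    simp_rw [← hmem]
    rw [← lintegral_indicator_one (hsec t)]
    rfl
  have hm : Measurable fun t : ℝ => negExp (∑' j, negLogOneSub
      (min (ENNReal.ofReal t) 1 * q.detectProb q.powW q.thrCS (w j))) :=
    measurable_negExp.comp (Measurable.tsum fun j => measurable_negLogOneSub.comp
      ((ENNReal.measurable_ofReal.min measurable_const).mul_const _))
  rw [← h2, h1]
  simp_rw [h3]
  rw [← lintegral_map (hm.const_mul (negExp (∑' k, negLogOneSub
    (q.detectProb q.powL q.thrED (z k))))) hT, hS.map_timer, lintegral_const_mul _ hm]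
  congr 1
  refine setLIntegral_congr_fun measurableSet_Icc fun t ht => ?_
  rw [min_eq_left (by simpa using ht.2)]

end IsModel

end Network

/-! ### The integrals N^L and N^W -/

namespace Parameters

variable (q : Parameters) {pow thr : ℝ}

lemma integrable_exp_pathLoss (hpow : 0 < pow) (hthr : 0 < thr) :
    Integrable fun x : Plane => Real.exp (-q.mu * (thr / pow) * q.pathLoss ‖x‖) := by
  have h0 : 0 < q.mu * (thr / pow) * (4 * Real.pi / q.wavelength) ^ 2 := by
    have := q.mu_pos
    have := q.wavelength_pos
    positivity
  -- In polar coordinates the integrand is r exp(-c r^α); the power s = 1 is the Jacobian of the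
  -- plane.
  have h1 := integrableOn_rpow_mul_exp_neg_mul_rpow (s := 1) (by norm_num) q.alpha_pos h0
  refine (integrable_fun_norm_addHaar (volume : Measure Plane)
    (f := fun r => Real.exp (-q.mu * (thr / pow) * q.pathLoss r))).2 (h1.congr_fun ?_
      measurableSet_Ioi)
  intro r _
  simp only [finrank_euclideanSpace_fin, Nat.add_one_sub_one, pow_one, Real.rpow_one, smul_eq_mul,
    pathLoss]
  congr 2
  ring

lemma meanContenders_eq (lam : ℝ) :
    q.meanContenders lam pow 0 0 thr =
      lam * ∫ x : Plane, Real.exp (-q.mu * (thr / pow) * q.pathLoss ‖x‖) := by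
  rw [meanContenders, Metric.closedBall_zero, restrict_compl_singleton]
  simp

lemma lintegral_detectProb (hpow : 0 < pow) (hthr : 0 < thr) :
    ∫⁻ z, q.detectProb pow thr z =
      ENNReal.ofReal (∫ x : Plane, Real.exp (-q.mu * (thr / pow) * q.pathLoss ‖x‖)) := by
  rw [ofReal_integral_eq_lintegral_ofReal (q.integrable_exp_pathLoss hpow hthr)
    (ae_of_all _ fun x => (Real.exp_pos _).le)]
  refine lintegral_congr_ae ?_
  filter_upwards [compl_mem_ae_iff.2 (measure_singleton (0 : Plane))] with z hz
  exact if_neg hz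

lemma ofReal_mul_lintegral_detectProb (hpow : 0 < pow) (hthr : 0 < thr) {lam : ℝ}
    (hlam : 0 ≤ lam) :
    ENNReal.ofReal lam * ∫⁻ z, q.detectProb pow thr z =
      ENNReal.ofReal (q.meanContenders lam pow 0 0 thr) := by
  rw [q.lintegral_detectProb hpow hthr, meanContenders_eq, ENNReal.ofReal_mul hlam]

lemma NL_nonneg : 0 ≤ q.NL := by
  rw [NL, meanContenders_eq]
  exact mul_nonneg q.lamL_nonneg (integral_nonneg fun x => (Real.exp_pos _).le)

lemma NW_pos : 0 < q.NW := by
  rw [NW, meanContenders_eq]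
  refine mul_pos q.lamW_pos ?_
  exact integral_exp_pos (q.integrable_exp_pathLoss q.powW_pos q.thrCS_pos)

end Parameters

lemma setLIntegral_Icc_exp_neg_mul {N : ℝ} (hN : 0 < N) :
    ∫⁻ t in Icc (0 : ℝ) 1, ENNReal.ofReal (Real.exp (-(t * N))) =
      ENNReal.ofReal ((1 - Real.exp (-N)) / N) := by
  have hc : Continuous fun t : ℝ => Real.exp (-(t * N)) := by fun_prop
  rw [← ofReal_integral_eq_lintegral_ofReal (hc.integrableOn_Icc)
    (ae_of_all _ fun t => (Real.exp_pos _).le), integral_Icc_eq_integral_Ioc,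
    ← intervalIntegral.integral_of_le zero_le_one]
  congr 1
  have hd : ∀ t ∈ uIcc (0 : ℝ) 1,
      HasDerivAt (fun t : ℝ => -Real.exp (-(t * N)) / N) (Real.exp (-(t * N))) t := fun t _ => by
    have h : HasDerivAt (fun t : ℝ => -(t * N)) (-N) t := by
      simpa using ((hasDerivAt_id t).mul_const N).fun_neg
    have h' : -(Real.exp (-(t * N)) * -N) / N = Real.exp (-(t * N)) := by
      field_simp
    exact h' ▸ h.exp.fun_neg.div_const N
  rw [intervalIntegral.integral_eq_sub_of_hasDerivAt hd (hc.intervalIntegrable _ _)]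
  simp
  ring

/-! ### Averaging over the Poisson locations -/

namespace Network.IsModel

variable {Ω ι κ : Type*} [MeasurableSpace Ω] {P : Measure Ω} [IsProbabilityMeasure P]
  {S : Network Ω ι κ} {q : Parameters}

lemma lintegral_negExp_enb [Countable κ] (hS : S.IsModel q P) (a : Plane) :
    ∫⁻ ω, negExp (∑' k, negLogOneSub (q.detectProb q.powL q.thrED (S.enb k ω - a))) ∂P =
      ENNReal.ofReal (Real.exp (-q.NL)) := by
  have hd : Measurable (q.detectProb q.powL q.thrED) :=
    (q.lowerSemicontinuous_detectProb _ _).measurable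
  rw [hS.enb_poisson.lintegral_negExp_tsum q.lamL_nonneg
    (φ := fun y => negLogOneSub (q.detectProb q.powL q.thrED (y - a)))
    (measurable_negLogOneSub.comp (hd.comp (measurable_id.sub_const a)))]
  simp_rw [one_sub_negExp_negLogOneSub (q.detectProb_le_one q.powL_pos q.thrED_pos _)]
  rw [lintegral_sub_right_eq_self (fun y => q.detectProb q.powL q.thrED y) a,
    q.ofReal_mul_lintegral_detectProb q.powL_pos q.thrED_pos q.lamL_nonneg,
    ← negExp_ofReal q.NL_nonneg]
  rfl

lemma tsum_lintegral_negExp_ap [Countable ι] (hS : S.IsModel q P) {B : Set Plane}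
    (hB : MeasurableSet B) (hB' : volume B ≠ ∞) {t : ℝ} (ht : t ∈ Icc (0 : ℝ) 1) :
    ∑' i, ∫⁻ ω, B.indicator 1 (S.ap i ω) * negExp (∑' j : {j // j ≠ i}, negLogOneSub
        (ENNReal.ofReal t * q.detectProb q.powW q.thrCS (S.ap j ω - S.ap i ω))) ∂P =
      ENNReal.ofReal q.lamW * volume B * ENNReal.ofReal (Real.exp (-(t * q.NW))) := by
  have hlsc : LowerSemicontinuous (Function.uncurry fun x y : Plane => negLogOneSub
      (ENNReal.ofReal t * q.detectProb q.powW q.thrCS (y - x))) := by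
    -- A continuous monotone function of a lower semicontinuous one is lower semicontinuous, so the
    -- Mecke formula applies.
    have h1 : Continuous fun r => negLogOneSub (ENNReal.ofReal t * r) :=
      continuous_negLogOneSub.comp (ENNReal.continuous_const_mul ENNReal.ofReal_ne_top)
    refine h1.comp_lowerSemicontinuous ((q.lowerSemicontinuous_detectProb q.powW q.thrCS).comp
      (continuous_snd.sub continuous_fst)) fun a b hab => monotone_negLogOneSub ?_
    exact mul_le_mul_right hab _
  have hle : ∀ z, ENNReal.ofReal t * q.detectProb q.powW q.thrCS z ≤ 1 := fun z =>
    mul_le_one' (by simpa using ht.2) (q.detectProb_le_one q.powW_pos q.thrCS_pos z)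
  have hd : Measurable (q.detectProb q.powW q.thrCS) :=
    (q.lowerSemicontinuous_detectProb _ _).measurable
  rw [hS.ap_poisson.tsum_lintegral_negExp q.lamW_pos.le hlsc hB hB']
  simp_rw [one_sub_negExp_negLogOneSub (hle _)]
  have hin : ∀ z : Plane, ENNReal.ofReal q.lamW * ∫⁻ y, ENNReal.ofReal t *
      q.detectProb q.powW q.thrCS (y - z) = ENNReal.ofReal (t * q.NW) := fun z => by
    have hdz : Measurable fun y => q.detectProb q.powW q.thrCS (y - z) :=
      hd.comp (measurable_id.sub_const z)
    rw [lintegral_const_mul _ hdz,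
      lintegral_sub_right_eq_self (fun y => q.detectProb q.powW q.thrCS y) z, mul_left_comm,
      q.ofReal_mul_lintegral_detectProb q.powW_pos q.thrCS_pos q.lamW_pos.le,
      ← ENNReal.ofReal_mul ht.1]
    rfl
  simp_rw [hin, negExp_ofReal (mul_nonneg ht.1 q.NW_pos.le)]
  rw [setLIntegral_const]
  ring

variable [Countable ι] [Countable κ]

/-- Marks and locations are independent, so the marks may be integrated first with the locations
held fixed. -/
lemma measurableSet_and_measure_access_eq_lintegral (hS : S.IsModel q P) {B : Set Plane}
    (hB : MeasurableSet B) (i : ι) :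
    MeasurableSet {ω | S.ap i ω ∈ B ∧ S.accessIndicator q i ω = 1} ∧
    P {ω | S.ap i ω ∈ B ∧ S.accessIndicator q i ω = 1} =
      ∫⁻ ω, B.indicator 1 (S.ap i ω) *
        (negExp (∑' k, negLogOneSub (q.detectProb q.powL q.thrED (S.enb k ω - S.ap i ω))) *
        ∫⁻ t in Icc (0 : ℝ) 1, negExp (∑' j : {j // j ≠ i}, negLogOneSub
          (ENNReal.ofReal t * q.detectProb q.powW q.thrCS (S.ap j ω - S.ap i ω)))) ∂P := by
  let E : Set (((ι → Plane) × (κ → Plane)) × (ι ⊕ (ι × ι) ⊕ (κ × ι) → ℝ)) :=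
    {p | p.1.1 i ∈ B} ∩
    ((⋂ k, {p | p.2 (Sum.inr (Sum.inr (k, i))) / q.pathLoss ‖p.1.2 k - p.1.1 i‖ ≤
      q.thrED / q.powL}) ∩
    ⋂ j : {j // j ≠ i}, ({p | p.2 (Sum.inl i) ≤ p.2 (Sum.inl (j : ι))} ∪
      {p | p.2 (Sum.inr (Sum.inl ((j : ι), i))) / q.pathLoss ‖p.1.1 j - p.1.1 i‖ ≤
        q.thrCS / q.powW}))
  have hpl : Measurable q.pathLoss := q.continuous_pathLoss.measurable
  have hE : MeasurableSet E := by
    refine MeasurableSet.inter ?_ ((MeasurableSet.iInter fun k => ?_).inter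
      (MeasurableSet.iInter fun j => MeasurableSet.union ?_ ?_))
    · exact ((measurable_pi_apply i).comp (measurable_fst.comp measurable_fst)) hB
    · exact measurableSet_le (by fun_prop) (by fun_prop)
    · exact measurableSet_le (by fun_prop) (by fun_prop)
    · exact measurableSet_le (by fun_prop) (by fun_prop)
  let X : Ω → (ι → Plane) × (κ → Plane) := fun ω => (fun i => S.ap i ω, fun k => S.enb k ω)
  let Y : Ω → ι ⊕ (ι × ι) ⊕ (κ × ι) → ℝ := fun ω m => S.marks m ω
  have hX : Measurable X := (measurable_pi_iff.2 hS.ap_poisson.measurable).prodMk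
    (measurable_pi_iff.2 hS.enb_poisson.measurable)
  have hY : Measurable Y := measurable_pi_iff.2 hS.measurable_marks
  have hmem : ∀ ω ω', (X ω, Y ω') ∈ E ↔ S.ap i ω ∈ B ∧
      (∀ k, S.fadLW k i ω' / q.pathLoss ‖S.enb k ω - S.ap i ω‖ ≤ q.thrED / q.powL) ∧
      ∀ j : {j // j ≠ i}, S.timer i ω' ≤ S.timer j ω' ∨
        S.fadW j i ω' / q.pathLoss ‖S.ap j ω - S.ap i ω‖ ≤ q.thrCS / q.powW := fun ω ω' => by
    simp only [E, X, Y, mem_inter_iff, mem_iInter, mem_union, mem_ofPred_eq, marks]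
  have hset : {ω | S.ap i ω ∈ B ∧ S.accessIndicator q i ω = 1} = {ω | (X ω, Y ω) ∈ E} := by
    ext ω
    simp only [mem_ofPred_eq, hmem, accessIndicator_eq_one_iff]
  have hmeas : MeasurableSet {ω | (X ω, Y ω) ∈ E} := (hX.prodMk hY) hE
  rw [hset]
  refine ⟨hmeas, ?_⟩
  have h1 := lintegral_comp_prodMk_of_indepFun hX hY hS.indep_locations_marks
    (F := E.indicator 1) (measurable_one.indicator hE)
  calc P {ω | (X ω, Y ω) ∈ E} = ∫⁻ ω, E.indicator 1 (X ω, Y ω) ∂P := by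
        rw [← lintegral_indicator_one hmeas]
        rfl
    _ = ∫⁻ ω, ∫⁻ ω', E.indicator 1 (X ω, Y ω') ∂P ∂P := h1
    _ = _ := by
        refine lintegral_congr fun ω => ?_
        rw [← hS.measure_access i (fun k => S.enb k ω - S.ap i ω)
          (fun j => S.ap j ω - S.ap i ω)]
        have hsec : MeasurableSet {ω' | (X ω, Y ω') ∈ E} := (measurable_const.prodMk hY) hE
        have h2 : ∫⁻ ω', E.indicator 1 (X ω, Y ω') ∂P = P {ω' | (X ω, Y ω') ∈ E} := by
          rw [← lintegral_indicator_one hsec]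
          rfl
        rw [h2]
        simp_rw [hmem]
        by_cases h : S.ap i ω ∈ B <;> simp [h]

/-- Given the APs, the eNB factor averages to exp(-N^L) independently of where the AP i is, so it
leaves the integral. Exchanging the timer and location integrals then allows the Mecke formula at
each fixed t. -/
lemma measure_access_eq (hS : S.IsModel q P) {B : Set Plane} (hB : MeasurableSet B) (i : ι) :
    P {ω | S.ap i ω ∈ B ∧ S.accessIndicator q i ω = 1} =
      ENNReal.ofReal (Real.exp (-q.NL)) * ∫⁻ t in Icc (0 : ℝ) 1, ∫⁻ ω, B.indicator 1 (S.ap i ω) *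
        negExp (∑' j : {j // j ≠ i}, negLogOneSub
          (ENNReal.ofReal t * q.detectProb q.powW q.thrCS (S.ap j ω - S.ap i ω))) ∂P := by
  have hdL : Measurable (q.detectProb q.powL q.thrED) :=
    (q.lowerSemicontinuous_detectProb _ _).measurable
  have hdW : Measurable (q.detectProb q.powW q.thrCS) :=
    (q.lowerSemicontinuous_detectProb _ _).measurable
  let W : (ι → Plane) × ℝ → ℝ≥0∞ := fun p => negExp (∑' j : {j // j ≠ i}, negLogOneSub
    (ENNReal.ofReal p.2 * q.detectProb q.powW q.thrCS (p.1 j - p.1 i)))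
  have hW : Measurable W := measurable_negExp.comp (Measurable.tsum fun j =>
    measurable_negLogOneSub.comp ((ENNReal.measurable_ofReal.comp measurable_snd).mul
      (hdW.comp (by fun_prop))))
  let L : (ι → Plane) × (κ → Plane) → ℝ≥0∞ := fun p =>
    negExp (∑' k, negLogOneSub (q.detectProb q.powL q.thrED (p.2 k - p.1 i)))
  have hL : Measurable L := measurable_negExp.comp (Measurable.tsum fun k =>
    measurable_negLogOneSub.comp (hdL.comp (by fun_prop)))
  have hI : Measurable fun a : ι → Plane => B.indicator (1 : Plane → ℝ≥0∞) (a i) :=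
    (measurable_one.indicator hB).comp (measurable_pi_apply i)
  have hWint : Measurable fun a : ι → Plane => ∫⁻ t in Icc (0 : ℝ) 1, W (a, t) :=
    hW.lintegral_prod_right'
  let X : Ω → ι → Plane := fun ω i => S.ap i ω
  let Y : Ω → κ → Plane := fun ω k => S.enb k ω
  have hX : Measurable X := measurable_pi_iff.2 hS.ap_poisson.measurable
  have hY : Measurable Y := measurable_pi_iff.2 hS.enb_poisson.measurable
  have h1 := lintegral_comp_prodMk_of_indepFun hX hY hS.indep_locations
    (F := fun p => B.indicator 1 (p.1 i) * (L p * ∫⁻ t in Icc (0 : ℝ) 1, W (p.1, t)))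
    ((hI.comp measurable_fst).mul (hL.mul (hWint.comp measurable_fst)))
  have hLY : ∀ a, Measurable fun ω' => L (a, Y ω') := fun a =>
    hL.comp (measurable_const.prodMk hY)
  have hWX : ∀ ω, Measurable fun t => W (X ω, t) := fun ω => hW.comp measurable_prodMk_left
  have hIW : Measurable fun p : Ω × ℝ => B.indicator 1 (X p.1 i) * W (X p.1, p.2) :=
    (hI.comp (hX.comp measurable_fst)).mul (hW.comp ((hX.comp measurable_fst).prodMk measurable_snd))
  rw [(hS.measurableSet_and_measure_access_eq_lintegral hB i).2]
  calc _ = ∫⁻ ω, ∫⁻ ω', B.indicator 1 (X ω i) *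
          (L (X ω, Y ω') * ∫⁻ t in Icc (0 : ℝ) 1, W (X ω, t)) ∂P ∂P := h1
    _ = ∫⁻ ω, ENNReal.ofReal (Real.exp (-q.NL)) *
          (∫⁻ t in Icc (0 : ℝ) 1, B.indicator 1 (X ω i) * W (X ω, t)) ∂P := by
        refine lintegral_congr fun ω => ?_
        have hLN : ∫⁻ ω', L (X ω, Y ω') ∂P = ENNReal.ofReal (Real.exp (-q.NL)) :=
          hS.lintegral_negExp_enb (S.ap i ω)
        rw [lintegral_const_mul _ ((hLY _).mul_const _), lintegral_mul_const _ (hLY _), hLN,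
          lintegral_const_mul _ (hWX ω), mul_left_comm]
    _ = ENNReal.ofReal (Real.exp (-q.NL)) *
          ∫⁻ ω, (∫⁻ t in Icc (0 : ℝ) 1, B.indicator 1 (X ω i) * W (X ω, t)) ∂P := by
        exact lintegral_const_mul _ (Measurable.lintegral_prod_right' hIW)
    _ = _ := by
        rw [lintegral_lintegral_swap hIW.aemeasurable]

/-- The expected number of APs in `B` which access the medium. -/
theorem tsum_measure_access (hS : S.IsModel q P) {B : Set Plane} (hB : MeasurableSet B)
    (hB' : volume B ≠ ∞) :
    ∑' i, P {ω | S.ap i ω ∈ B ∧ S.accessIndicator q i ω = 1} =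
      ENNReal.ofReal (Real.exp (-q.NL) * ((1 - Real.exp (-q.NW)) / q.NW)) *
        (ENNReal.ofReal q.lamW * volume B) := by
  have hdW : Measurable (q.detectProb q.powW q.thrCS) :=
    (q.lowerSemicontinuous_detectProb _ _).measurable
  have hmeas : ∀ i, Measurable fun t : ℝ => ∫⁻ ω, B.indicator 1 (S.ap i ω) *
        negExp (∑' j : {j // j ≠ i}, negLogOneSub
          (ENNReal.ofReal t * q.detectProb q.powW q.thrCS (S.ap j ω - S.ap i ω))) ∂P := fun i => by
    have hap := hS.ap_poisson.measurable
    refine Measurable.lintegral_prod_right' (f := fun p : ℝ × Ω => B.indicator 1 (S.ap i p.2) *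
        negExp (∑' j : {j // j ≠ i}, negLogOneSub
          (ENNReal.ofReal p.1 * q.detectProb q.powW q.thrCS (S.ap j p.2 - S.ap i p.2)))) ?_
    refine ((measurable_one.indicator hB).comp ((hap i).comp measurable_snd)).mul
      (measurable_negExp.comp (Measurable.tsum fun j => measurable_negLogOneSub.comp
        ((ENNReal.measurable_ofReal.comp measurable_fst).mul (hdW.comp ?_))))
    exact ((hap j).comp measurable_snd).sub ((hap i).comp measurable_snd)
  simp_rw [hS.measure_access_eq hB]
  rw [ENNReal.tsum_mul_left, ← lintegral_tsum fun i => (hmeas i).aemeasurable,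
    setLIntegral_congr_fun measurableSet_Icc fun t ht => hS.tsum_lintegral_negExp_ap hB hB' ht,
    lintegral_const_mul _ (by fun_prop), setLIntegral_Icc_exp_neg_mul q.NW_pos,
    ENNReal.ofReal_mul (Real.exp_pos _).le]
  ring

end Network.IsModel

end WifiLte

end

theorem mainTheorem1 {Ω ι κ : Type*} [MeasurableSpace Ω] [Countable ι] [Countable κ]
    (P : Measure Ω) [IsProbabilityMeasure P] (q : WifiLte.Parameters)
    (S : WifiLte.Network Ω ι κ) (hS : S.IsModel q P) :
    Integrable (fun x : WifiLte.Plane =>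
        Real.exp (-q.mu * (q.thrED / q.powL) * q.pathLoss ‖x‖)) ∧
    Integrable (fun x : WifiLte.Plane =>
        Real.exp (-q.mu * (q.thrCS / q.powW) * q.pathLoss ‖x‖)) ∧
    0 < q.NW ∧
    ∀ B : Set WifiLte.Plane, MeasurableSet B → volume B ≠ 0 → volume B ≠ ∞ →
      S.mediumAccessProb q P B =
        ENNReal.ofReal (Real.exp (-q.NL) * ((1 - Real.exp (-q.NW)) / q.NW)) := by
  refine ⟨q.integrable_exp_pathLoss q.powL_pos q.thrED_pos,
    q.integrable_exp_pathLoss q.powW_pos q.thrCS_pos, q.NW_pos, fun B hB hB0 hB1 => ?_⟩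
  have hm : ∀ i, MeasurableSet {ω | S.ap i ω ∈ B ∧ S.accessIndicator q i ω = 1} := fun i =>
    (hS.measurableSet_and_measure_access_eq_lintegral hB i).1
  have h0 : ENNReal.ofReal q.lamW * volume B ≠ 0 :=
    mul_ne_zero (by simpa using q.lamW_pos) hB0
  have h1 : ENNReal.ofReal q.lamW * volume B ≠ ∞ := ENNReal.mul_ne_top ENNReal.ofReal_ne_top hB1
  rw [WifiLte.Network.mediumAccessProb,
    lintegral_tsum fun i => (measurable_one.indicator (hm i)).aemeasurable]
  simp_rw [lintegral_indicator_one (hm _)]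
  rw [hS.tsum_measure_access hB hB1, ENNReal.mul_div_cancel_right h0 h1]
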